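/- Let $m\ge 1$ and $1<p<\infty$. For $k\in\mathbb Z$ let $\mathscr D_k$ be the collection of standard half-open dyadic cubes $\prod_{j=1}^m[n_j2^{-k},(n_j+1)2^{-k})$, $n\in\mathbb Z^m$, in $\mathbb R^m$. On $\mathbb R^{2m}=\mathbb R^m\times\mathbb R^m$ let $$T_1(x_1,x_2)=(x_1,x_2),\qquad T_2(x_1,x_2)=(x_1-x_2,x_2),\qquad T_3(x_1,x_2)=(x_1,x_2-x_1).$$ For $i\in\{1,2,3\}$ and $\mathbf k=(k_1,k_2)\in\mathbb Z^2$, the tiles of system $i$ at scale $\mathbf k$ are the sets $T_i^{-1}(I\times J)$ with $I\in\mathscr D_{k_1}$, $J\in\mathscr D_{k_2}$; they partition $\mathbb R^{2m}$. For locally integrable $f:\mathbb R^{2m}\to\mathbb C$ let $$E^{(i)}_{\mathbf k}f(\mathbf x)=\sum_{I\in\mathscr D_{k_1}}\sum_{J\in\mathscr D_{k_2}}\left(\frac1{|R|}\int_{R}f(\mathbf y)\,d\mathbf y\right)\chi_{R}(\mathbf x),\qquad R=T_i^{-1}(I\times J),$$ be the conditional expectation with respect to the $\sigma$-algebra generated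 by these tiles, and define the bi-parameter martingale differences and square function by $$\Delta^{(i)}_{\mathbf k}f=E^{(i)}_{k_1+1,k_2+1}f-E^{(i)}_{k_1,k_2+1}f-E^{(i)}_{k_1+1,k_2}f+E^{(i)}_{k_1,k_2}f,\qquad S^{(i)}_{mart}(f)(\mathbf x)=\Big(\sum_{\mathbf k\in\mathbb Z^2}\big|\Delta^{(i)}_{\mathbf k}f(\mathbf x)\big|^2\Big)^{1/2}\in[0,\infty].$$ **Theorem (twisted Burkholder–Davis–Gundy inequalities).** There are constants $c,C\in(0,\infty)$, depending only on $p$ and $m$, such that for every $i\in\{1,2,3\}$ and every $f\in L^p(\mathbb R^{2m})$ one has $S^{(i)}_{mart}(f)\in L^p(\mathbb R^{2m})$ and $$c\,\|f\|_{L^p(\mathbb R^{2m})}\le\big\|S^{(i)}_{mart}(f)\big\|_{L^p(\mathbb R^{2m})}\le C\,\|f\|_{L^p(\mathbb R^{2m})}.$$ -/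

import Mathlib

open MeasureTheory
open scoped ENNReal NNReal

noncomputable section

namespace TwistedDyadic

/-- `ℝ^m` as a measure space; its `volume` is Lebesgue measure. -/
abbrev Rm (m : ℕ) : Type := Fin m → ℝ

/-- The standard (half-open) dyadic cube of side length `2 ^ (-k)` in `ℝ^m` with lower corner
`2 ^ (-k) * n`, where `n ∈ ℤ^m`. -/
def dyadicCube {m : ℕ} (k : ℤ) (n : Fin m → ℤ) : Set (Rm m) :=
  {x | ∀ j, (n j : ℝ) * (2 : ℝ) ^ (-k) ≤ x j ∧ x j < ((n j : ℝ) + 1) * (2 : ℝ) ^ (-k)}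

/-- The three shears of `ℝ^m × ℝ^m`, the indices `0, 1, 2` standing for the systems 1, 2, 3:
the identity, `T₂ (x₁, x₂) = (x₁ - x₂, x₂)` and `T₃ (x₁, x₂) = (x₁, x₂ - x₁)`. -/
def shear {m : ℕ} : Fin 3 → Rm m × Rm m → Rm m × Rm m
  | 0, x => x
  | 1, x => (x.1 - x.2, x.2)
  | 2, x => (x.1, x.2 - x.1)

/-- The tile `T_i⁻¹ (I × J)` of system `i`, where `I`, `J` are the dyadic cubes of side lengths
`2 ^ (-k.1)`, `2 ^ (-k.2)` with indices `n.1`, `n.2`. For `i = 1` this is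
`{(x₁, x₂) | x₁ - x₂ ∈ I, x₂ ∈ J}` and for `i = 2` it is `{(x₁, x₂) | x₁ ∈ I, x₂ - x₁ ∈ J}`. For
fixed `i` and `k` the tiles partition `ℝ^m × ℝ^m`, and they are the atoms of the `σ`-algebra
of system `i` at scale `k`. -/
def tile {m : ℕ} (i : Fin 3) (k : ℤ × ℤ) (n : (Fin m → ℤ) × (Fin m → ℤ)) :
    Set (Rm m × Rm m) :=
  shear i ⁻¹' (dyadicCube k.1 n.1 ×ˢ dyadicCube k.2 n.2)

/-- The conditional expectation `E_k^{(i)}` on locally integrable functions: at each point of a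
tile its value is the average of `f` over that tile. -/
def expect {m : ℕ} (i : Fin 3) (k : ℤ × ℤ) (f : Rm m × Rm m → ℂ) : Rm m × Rm m → ℂ :=
  fun x => ∑' n : (Fin m → ℤ) × (Fin m → ℤ),
    (tile i k n).indicator (fun _ => ⨍ y in tile i k n, f y) x

/-- The bi-parameter martingale difference `Δ_k^{(i)}`: the successive differences in both
parameters, `E_{k₁+1,k₂+1} - E_{k₁,k₂+1} - E_{k₁+1,k₂} + E_{k₁,k₂}`. -/
def mdiff {m : ℕ} (i : Fin 3) (k : ℤ × ℤ) (f : Rm m × Rm m → ℂ) : Rm m × Rm m → ℂ :=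
  fun x => (expect i (k.1 + 1, k.2 + 1) f x - expect i (k.1, k.2 + 1) f x)
    - (expect i (k.1 + 1, k.2) f x - expect i (k.1, k.2) f x)

/-- The martingale square function `S_mart^{(i)} f = (∑_{k ∈ ℤ²} |Δ_k^{(i)} f|²)^{1/2}`, with
values in `[0, ∞]`. -/
def martSquare {m : ℕ} (i : Fin 3) (f : Rm m × Rm m → ℂ) : Rm m × Rm m → ℝ≥0∞ :=
  fun x => (∑' k : ℤ × ℤ, ‖mdiff i k f x‖ₑ ^ 2) ^ (1 / 2 : ℝ)

end TwistedDyadic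

end

/-! The shears preserve Lebesgue measure and the tiles of each system are preimages of product
tiles, so the square function of `g ∘ T` in a sheared system is the product one of `g`, composed
with `T` (`martSquare_comp_shear`). Only the product system, index `0`, needs work.

There the bi-parameter inequality is an iteration of the one-parameter inequality for Hilbert space
valued martingales (`exists_tsum_biSq_bounds`). For a frozen first variable, the vector of all
differences in the first parameter is a martingale in the second parameter. Its square function is
the bi-parameter one, while the norm of its last value is a one-parameter square function in the
first variable. Tonelli allows the two variables to be treated in turn.

The one-parameter upper bound comes from a Bellman function `U x t` of the current value `x` and the
accumulated square function `t`: it is nonpositive at `t = 0`, its mean does not increase under a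
martingale step, and it dominates `t ^ (p / 2) - C * ‖x‖ ^ p`. Explicit choices exist for `p ≤ 2`
and for `2 ≤ p`; both rest on quantitative convexity of `‖·‖ ^ p`. The lower bound is dual to the
upper bound at the conjugate exponent (`childAvg_pow_norm_le`). Constants depend on `p` and on the
branching number `2 ^ m`, never on the number of generations or on the Hilbert space.

These estimates concern finite windows of scales, where a martingale is a family of finite averages
on a tree. Fatou's lemma removes the truncation. The differences in a window telescope to four
expectations: one tends to `f` almost everywhere by Lebesgue differentiation, and three vanish
because their tiles have volume tending to infinity (`ae_tendsto_truncSum`). -/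

noncomputable section

namespace TwistedDyadic

/-! ### Convexity inequalities and Bellman functions -/

section Bellman

/-- The tangent line of a concave power lies above it. -/
theorem add_rpow_le_tangent {s u q : ℝ} (hs : 0 < s) (hu : 0 ≤ s + u) (hq : 0 ≤ q)
    (hq1 : q ≤ 1) : (s + u) ^ q ≤ s ^ q + q * s ^ (q - 1) * u := by
  have h1 : -1 ≤ u / s := by rw [le_div_iff₀ hs]; linarith
  have h := rpow_one_add_le_one_add_mul_self h1 hq hq1
  have e : s + u = s * (1 + u / s) := by field_simp
  rw [e, Real.mul_rpow hs.le (by linarith), Real.rpow_sub_one hs.ne']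
  calc s ^ q * (1 + u / s) ^ q ≤ s ^ q * (1 + q * (u / s)) :=
        mul_le_mul_of_nonneg_left h (by positivity)
    _ = _ := by field_simp

/-- The tangent line of a convex power lies below it. -/
theorem tangent_le_add_rpow {s u q : ℝ} (hs : 0 < s) (hu : 0 ≤ s + u) (hq1 : 1 ≤ q) :
    s ^ q + q * s ^ (q - 1) * u ≤ (s + u) ^ q := by
  have h1 : -1 ≤ u / s := by rw [le_div_iff₀ hs]; linarith
  have h := one_add_mul_self_le_rpow_one_add h1 hq1
  have e : s + u = s * (1 + u / s) := by field_simp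
  rw [e, Real.mul_rpow hs.le (by linarith), Real.rpow_sub_one hs.ne']
  calc _ = s ^ q * (1 + q * (u / s)) := by field_simp
    _ ≤ s ^ q * (1 + u / s) ^ q := mul_le_mul_of_nonneg_left h (by positivity)

theorem sq_rpow_half {r : ℝ} (hr : 0 ≤ r) (p : ℝ) : (r ^ 2) ^ (p / 2) = r ^ p := by
  rw [← Real.rpow_natCast, ← Real.rpow_mul hr]; congr 1; push_cast; ring

theorem add_rpow_le_two_rpow_mul {s u q : ℝ} (hs : 0 ≤ s) (hu : 0 ≤ u) (hq : 0 ≤ q) :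
    (s + u) ^ q ≤ 2 ^ q * (s ^ q + u ^ q) := by
  have hs' := Real.rpow_nonneg hs q
  have hu' := Real.rpow_nonneg hu q
  rcases le_total s u with h | h
  · calc (s + u) ^ q ≤ (2 * u) ^ q := Real.rpow_le_rpow (by positivity) (by linarith) hq
      _ = 2 ^ q * u ^ q := Real.mul_rpow (by norm_num) hu
      _ ≤ _ := by gcongr; linarith
  · calc (s + u) ^ q ≤ (2 * s) ^ q := Real.rpow_le_rpow (by positivity) (by linarith) hq
      _ = 2 ^ q * s ^ q := Real.mul_rpow (by norm_num) hs
      _ ≤ _ := by gcongr; linarith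

variable {H : Type*} [NormedAddCommGroup H] [InnerProductSpace ℝ H]
variable {ε : Type*} [Fintype ε]

theorem sum_norm_add_sq {d : ε → H} (hd : ∑ e, d e = 0) (x : H) :
    ∑ e, ‖x + d e‖ ^ 2 = Fintype.card ε * ‖x‖ ^ 2 + ∑ e, ‖d e‖ ^ 2 := by
  have : ∀ e, ‖x + d e‖ ^ 2 = ‖x‖ ^ 2 + 2 * inner ℝ x (d e) + ‖d e‖ ^ 2 :=
    fun e => norm_add_sq_real x (d e)
  simp only [this, Finset.sum_add_distrib, ← Finset.mul_sum, ← inner_sum, hd]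
  simp

theorem card_mul_norm_le {d : ε → H} (hd : ∑ e, d e = 0) (x : H) :
    Fintype.card ε * ‖x‖ ≤ ∑ e, ‖x + d e‖ := by
  have : ∑ e, (x + d e) = (Fintype.card ε : ℝ) • x := by
    rw [Finset.sum_add_distrib, hd, add_zero]; simp [← Nat.cast_smul_eq_nsmul ℝ]
  calc (Fintype.card ε : ℝ) * ‖x‖ = ‖∑ e, (x + d e)‖ := by rw [this, norm_smul]; simp
    _ ≤ _ := norm_sum_le _ _

/-- Jensen's inequality for equal weights and a monotone convex function of the norm. -/
theorem card_mul_comp_norm_le [Nonempty ε] {g : ℝ → ℝ} {L : ℝ}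
    (hc : ConvexOn ℝ (Set.Icc 0 L) g) (hm : MonotoneOn g (Set.Icc 0 L)) {d : ε → H}
    (hd : ∑ e, d e = 0) {x : H} (hL : ∀ e, ‖x + d e‖ ≤ L) :
    Fintype.card ε * g ‖x‖ ≤ ∑ e, g ‖x + d e‖ := by
  have hN : (0 : ℝ) < Fintype.card ε := by exact_mod_cast Fintype.card_pos
  have h1 : ∑ e : ε, (Fintype.card ε : ℝ)⁻¹ = 1 := by simp [hN.ne']
  have hj := hc.map_sum_le (t := Finset.univ) (w := fun _ : ε => (Fintype.card ε : ℝ)⁻¹)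
    (p := fun e => ‖x + d e‖) (fun _ _ => by positivity) h1
    (fun e _ => ⟨norm_nonneg _, hL e⟩)
  simp only [smul_eq_mul, ← Finset.mul_sum] at hj
  have hx : ‖x‖ ≤ (Fintype.card ε : ℝ)⁻¹ * ∑ e, ‖x + d e‖ := by
    rw [inv_mul_eq_div, le_div_iff₀ hN, mul_comm]; exact card_mul_norm_le hd x
  have hL' : (Fintype.card ε : ℝ)⁻¹ * ∑ e, ‖x + d e‖ ≤ L := by
    rw [inv_mul_eq_div, div_le_iff₀ hN, mul_comm]
    calc _ ≤ ∑ _e : ε, L := Finset.sum_le_sum fun e _ => hL e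
      _ = _ := by simp
  have hg := (hm ⟨norm_nonneg x, hx.trans hL'⟩ ⟨(norm_nonneg x).trans hx, hL'⟩ hx).trans hj
  rwa [inv_mul_eq_div, le_div_iff₀ hN, mul_comm] at hg

theorem hasDerivAt_rpow_sub_mul_sq {p κ r : ℝ} (hr : 0 < r) :
    HasDerivAt (fun r : ℝ => r ^ p - κ * r ^ 2) (p * r ^ (p - 1) - κ * (2 * r)) r := by
  have h1 := Real.hasDerivAt_rpow_const (x := r) (p := p) (Or.inl hr.ne')
  have h2 := (hasDerivAt_pow 2 r).const_mul κ
  exact (h1.sub h2).congr_deriv (by norm_num)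

/-- The second derivative `p * (p - 1) * r ^ (p - 2) - 2 * κ` is smallest at `r = L`, since `p ≤ 2`;
this dictates the bound on `κ`. -/
theorem convexOn_rpow_sub_mul_sq {p L κ : ℝ} (hp : 1 < p) (hp2 : p ≤ 2)
    (hκ : κ ≤ p * (p - 1) / 2 * L ^ (p - 2)) :
    ConvexOn ℝ (Set.Icc 0 L) (fun r : ℝ => r ^ p - κ * r ^ 2) := by
  refine convexOn_of_hasDerivWithinAt2_nonneg (convex_Icc _ _)
    (f' := fun r => p * r ^ (p - 1) - κ * (2 * r))
    (f'' := fun r => p * ((p - 1) * r ^ (p - 1 - 1)) - κ * 2) ?_ ?_ ?_ ?_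
  · exact ((Real.continuous_rpow_const (by linarith)).sub (by fun_prop)).continuousOn
  · intro r hr
    rw [interior_Icc] at hr
    exact (hasDerivAt_rpow_sub_mul_sq hr.1).hasDerivWithinAt
  · intro r hr
    rw [interior_Icc] at hr
    have h1 := (Real.hasDerivAt_rpow_const (x := r) (p := p - 1) (Or.inl hr.1.ne')).const_mul p
    have h2 := ((hasDerivAt_id r).const_mul 2).const_mul κ
    have h3 := (h1.sub h2).hasDerivWithinAt (s := interior (Set.Icc 0 L))
    exact h3.congr_deriv (by ring)
  · intro r hr
    rw [interior_Icc] at hr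
    have h1 : L ^ (p - 2) ≤ r ^ (p - 2) :=
      Real.rpow_le_rpow_of_nonpos hr.1 hr.2.le (by linarith)
    have h2 : p * (p - 1) * L ^ (p - 2) ≤ p * (p - 1) * r ^ (p - 2) :=
      mul_le_mul_of_nonneg_left h1 (mul_nonneg (by linarith) (by linarith))
    have h3 : p - 1 - 1 = p - 2 := by ring
    simp only [h3]
    linarith

theorem monotoneOn_rpow_sub_mul_sq {p L κ : ℝ} (hp : 1 < p) (hp2 : p ≤ 2)
    (hκ : κ ≤ p * (p - 1) / 2 * L ^ (p - 2)) :
    MonotoneOn (fun r : ℝ => r ^ p - κ * r ^ 2) (Set.Icc 0 L) := by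
  refine monotoneOn_of_hasDerivWithinAt_nonneg (convex_Icc _ _)
    (f' := fun r => p * r ^ (p - 1) - κ * (2 * r)) ?_ ?_ ?_
  · exact ((Real.continuous_rpow_const (by linarith)).sub (by fun_prop)).continuousOn
  · intro r hr
    rw [interior_Icc] at hr
    exact (hasDerivAt_rpow_sub_mul_sq hr.1).hasDerivWithinAt
  · intro r hr
    rw [interior_Icc] at hr
    have h1 : L ^ (p - 2) ≤ r ^ (p - 2) :=
      Real.rpow_le_rpow_of_nonpos hr.1 hr.2.le (by linarith)
    have h0 : 0 ≤ L ^ (p - 2) := Real.rpow_nonneg (hr.1.le.trans hr.2.le) _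
    have h2 : r ^ (p - 1) = r ^ (p - 2) * r := by
      rw [← Real.rpow_add_one hr.1.ne']; congr 1; ring
    have h3 : p * (p - 1) * L ^ (p - 2) ≤ p * L ^ (p - 2) := by
      have : 0 ≤ p * L ^ (p - 2) := mul_nonneg (by linarith) h0
      nlinarith
    have h4 : p * L ^ (p - 2) ≤ p * r ^ (p - 2) := mul_le_mul_of_nonneg_left h1 (by linarith)
    have h5 : 0 ≤ r * (p * r ^ (p - 2) - 2 * κ) := mul_nonneg hr.1.le (by linarith)
    simp only [h2]
    linarith

/-- Quantitative convexity of `‖·‖ ^ p` for `1 < p ≤ 2`. -/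
theorem card_mul_norm_rpow_add_le [Nonempty ε] {p : ℝ} (hp : 1 < p) (hp2 : p ≤ 2)
    {d : ε → H} (hd : ∑ e, d e = 0) {x : H} {L : ℝ} (hL : ∀ e, ‖x + d e‖ ≤ L) :
    Fintype.card ε * ‖x‖ ^ p + p * (p - 1) / 2 * L ^ (p - 2) * ∑ e, ‖d e‖ ^ 2
      ≤ ∑ e, ‖x + d e‖ ^ p := by
  -- Jensen for `r ^ p - κ * r ^ 2` with the largest admissible `κ`; the exact variance identity for
  -- squares turns the subtracted term into the gain.
  have h := card_mul_comp_norm_le (convexOn_rpow_sub_mul_sq hp hp2 le_rfl)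
    (monotoneOn_rpow_sub_mul_sq hp hp2 le_rfl) hd hL
  simp only [Finset.sum_sub_distrib, ← Finset.mul_sum, sum_norm_add_sq hd x] at h
  linarith

/-- Quantitative convexity of `‖·‖ ^ p` for `2 ≤ p`. -/
theorem card_mul_norm_rpow_add_sum_le [Nonempty ε] {p : ℝ} (hp : 2 ≤ p)
    {d : ε → H} (hd : ∑ e, d e = 0) (x : H) :
    Fintype.card ε * ‖x‖ ^ p + 2 * 2⁻¹ ^ p * ∑ e, ‖d e‖ ^ p ≤ ∑ e, ‖x + d e‖ ^ p := by
  have hq : 1 ≤ p / 2 := by linarith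
  -- The parallelogram law at the midpoint of `x` and `x + d e`, raised to the power `p / 2`:
  -- superadditivity on the left, convexity on the right. Jensen for the half steps then removes the
  -- midpoints.
  have key : ∀ e, ‖x + (2⁻¹ : ℝ) • d e‖ ^ p + 2⁻¹ ^ p * ‖d e‖ ^ p
      ≤ 2⁻¹ * ‖x + d e‖ ^ p + 2⁻¹ * ‖x‖ ^ p := by
    intro e
    have hpar : ‖x + (2⁻¹ : ℝ) • d e‖ ^ 2 + ‖(2⁻¹ : ℝ) • d e‖ ^ 2
        = 2⁻¹ * ‖x + d e‖ ^ 2 + 2⁻¹ * ‖x‖ ^ 2 := by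
      rw [norm_add_sq_real, norm_add_sq_real, inner_smul_right, norm_smul]; norm_num; ring
    have h1 := Real.add_rpow_le_rpow_add (sq_nonneg ‖x + (2⁻¹ : ℝ) • d e‖)
      (sq_nonneg ‖(2⁻¹ : ℝ) • d e‖) hq
    have h2 := (convexOn_rpow hq).2 (x := ‖x + d e‖ ^ 2) (y := ‖x‖ ^ 2)
      (sq_nonneg ‖x + d e‖) (sq_nonneg ‖x‖)
      (by norm_num : (0 : ℝ) ≤ 2⁻¹) (by norm_num : (0 : ℝ) ≤ 2⁻¹) (by norm_num)
    simp only [smul_eq_mul] at h2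
    rw [hpar] at h1
    have h3 := h1.trans h2
    simp only [sq_rpow_half (norm_nonneg _)] at h3
    rwa [norm_smul, Real.mul_rpow (norm_nonneg _) (norm_nonneg _), Real.norm_of_nonneg
      (by norm_num)] at h3
  have hd2 : ∑ e, (2⁻¹ : ℝ) • d e = 0 := by rw [← Finset.smul_sum, hd, smul_zero]
  obtain ⟨L, hL⟩ : ∃ L, ∀ e, ‖x + (2⁻¹ : ℝ) • d e‖ ≤ L :=
    ⟨∑ e, ‖x + (2⁻¹ : ℝ) • d e‖, fun e => Finset.single_le_sum
      (f := fun e => ‖x + (2⁻¹ : ℝ) • d e‖) (fun _ _ => norm_nonneg _) (Finset.mem_univ e)⟩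
  have hj := card_mul_comp_norm_le (g := fun r : ℝ => r ^ p)
    ((convexOn_rpow (by linarith : 1 ≤ p)).subset (fun r hr => hr.1) (convex_Icc 0 L))
    ((Real.monotoneOn_rpow_Ici_of_exponent_nonneg (by linarith)).mono fun r hr => hr.1) hd2 hL
  have hs := Finset.sum_le_sum fun e (_ : e ∈ Finset.univ) => key e
  simp only [Finset.sum_add_distrib, ← Finset.mul_sum, Finset.sum_const, Finset.card_univ,
    nsmul_eq_mul] at hs
  linarith

/-- A Bellman function for the upper square function estimate with exponent `p`: a function
`U` that controls `t ^ (p / 2)` and does not increase on average under martingale steps with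
`N` equally likely outcomes. -/
structure IsBellman (H ε : Type*) [NormedAddCommGroup H] [Fintype ε] (p C : ℝ)
    (U : H → ℝ → ℝ) : Prop where
  zero : ∀ x, U x 0 ≤ 0
  rpow_le : ∀ x t, 0 ≤ t → t ^ (p / 2) ≤ C * ‖x‖ ^ p + U x t
  step : ∀ x t, 0 ≤ t → ∀ d : ε → H, ∑ e, d e = 0 →
    ∑ e, U (x + d e) (t + ‖d e‖ ^ 2) ≤ Fintype.card ε * U x t

/-- The concave power grows by at most second order in the step, and the convexity gain of `C * ‖x‖
^ p` pays for this. The factor `(p - 1)⁻¹` compensates the degenerating convexity as `p → 1`; the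
number of children enters when one jump dominates. -/
theorem isBellman_of_le_two (H : Type*) [NormedAddCommGroup H] [InnerProductSpace ℝ H]
    (ε : Type*) [Fintype ε] [Nonempty ε] {p : ℝ} (hp : 1 < p) (hp2 : p ≤ 2) :
    IsBellman H ε p (40 * Fintype.card ε / (p - 1))
      (fun x t => (‖x‖ ^ 2 + t) ^ (p / 2) - 40 * Fintype.card ε / (p - 1) * ‖x‖ ^ p) := by
  have hN : (1 : ℝ) ≤ Fintype.card ε := by exact_mod_cast Fintype.card_pos
  have hp0 : 0 < p - 1 := by linarith
  set N : ℝ := (Fintype.card ε : ℝ)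
  set C : ℝ := 40 * N / (p - 1) with hC
  have hC1 : 1 ≤ C := by rw [hC, le_div_iff₀ hp0]; linarith
  refine ⟨fun x => ?_, fun x t ht => ?_, fun x t ht d hd => ?_⟩
  · simp only [add_zero, sq_rpow_half (norm_nonneg _)]
    have := Real.rpow_nonneg (norm_nonneg x) p
    nlinarith
  · have : t ^ (p / 2) ≤ (‖x‖ ^ 2 + t) ^ (p / 2) :=
      Real.rpow_le_rpow ht (by nlinarith [sq_nonneg ‖x‖]) (by linarith)
    linarith
  · simp only [Finset.sum_sub_distrib, ← Finset.mul_sum]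
    obtain ⟨e₀, -, he₀⟩ := Finset.exists_max_image Finset.univ (fun e => ‖d e‖)
      Finset.univ_nonempty
    set D := ‖d e₀‖
    have hD : ∀ e, ‖d e‖ ≤ D := fun e => he₀ e (Finset.mem_univ e)
    rcases (norm_nonneg (d e₀)).eq_or_lt with h0 | h0
    · have : ∀ e, d e = 0 := fun e => norm_le_zero_iff.1 ((hD e).trans h0.symm.le)
      simp only [this, add_zero, norm_zero]
      norm_num
      linarith
    change 0 < D at h0
    set V := ∑ e, ‖d e‖ ^ 2 with hV
    have hDV : D ^ 2 ≤ V := Finset.single_le_sum (f := fun e => ‖d e‖ ^ 2)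
      (fun _ _ => sq_nonneg _) (Finset.mem_univ e₀)
    have hconv := card_mul_norm_rpow_add_le hp hp2 hd (x := x) (L := ‖x‖ + D)
      (fun e => (norm_add_le _ _).trans (by linarith [hD e]))
    rw [← hV] at hconv
    set κ := p * (p - 1) / 2 * (‖x‖ + D) ^ (p - 2) with hκ
    have hCκ : C * κ = 20 * N * p * (‖x‖ + D) ^ (p - 2) := by
      rw [hC, hκ]; field_simp; ring
    set s := ‖x‖ ^ 2 + t with hs
    have hs0 : 0 ≤ s := by positivity
    have hxs : ‖x‖ ≤ √s := Real.le_sqrt_of_sq_le (by linarith)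
    have hterm : ∀ e, ‖x + d e‖ ^ 2 + (t + ‖d e‖ ^ 2)
        = s + (2 * inner ℝ x (d e) + 2 * ‖d e‖ ^ 2) := by
      intro e; rw [norm_add_sq_real]; ring
    simp only [hterm]
    have hnn : ∀ e, 0 ≤ s + (2 * inner ℝ x (d e) + 2 * ‖d e‖ ^ 2) := by
      intro e; rw [← hterm]; positivity
    have hhalf : ∀ r : ℝ, 0 < r → 2⁻¹ * r ^ (p - 2) ≤ (2 * r) ^ (p - 2) := by
      intro r hr
      rw [Real.mul_rpow (by norm_num) hr.le]
      refine mul_le_mul_of_nonneg_right ?_ (Real.rpow_nonneg hr.le _)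
      rw [← Real.rpow_neg_one]
      exact Real.rpow_le_rpow_of_exponent_le (by norm_num) (by linarith)
    suffices hmain : ∑ e, (s + (2 * inner ℝ x (d e) + 2 * ‖d e‖ ^ 2)) ^ (p / 2)
        ≤ N * s ^ (p / 2) + C * κ * V by
      have : C * (N * ‖x‖ ^ p + κ * V) ≤ C * ∑ e, ‖x + d e‖ ^ p :=
        mul_le_mul_of_nonneg_left hconv (by linarith)
      linarith
    -- If the largest jump `D` dominates, each of the `N` terms is crudely at most `5 * D ^ p`, and
    -- `D ^ 2 ≤ V`. Otherwise the tangent line at `s` works, its part linear in `d` summing to zero.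
    -- In both cases `‖x‖ + D` is at most twice the dominant quantity, which costs a factor `2⁻¹`.
    rcases le_total s (D ^ 2) with hsD | hsD
    · have hxD : ‖x‖ ≤ D := by
        have : ‖x‖ ^ 2 ≤ D ^ 2 := by linarith
        exact abs_le_of_sq_le_sq' this h0.le |>.2
      have hle : ∀ e, (s + (2 * inner ℝ x (d e) + 2 * ‖d e‖ ^ 2)) ^ (p / 2) ≤ 5 * D ^ p := by
        intro e
        have h1 : inner ℝ x (d e) ≤ D * D :=
          (real_inner_le_norm _ _).trans (mul_le_mul hxD (hD e) (norm_nonneg _) h0.le)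
        have h2 : ‖d e‖ ^ 2 ≤ D ^ 2 := by gcongr; exact hD e
        calc _ ≤ (5 * D ^ 2) ^ (p / 2) :=
              Real.rpow_le_rpow (hnn e) (by nlinarith) (by linarith)
          _ = 5 ^ (p / 2) * D ^ p := by
              rw [Real.mul_rpow (by norm_num) (by positivity), sq_rpow_half h0.le]
          _ ≤ 5 ^ (1 : ℝ) * D ^ p := by
              gcongr
              · norm_num
              · linarith
          _ = _ := by norm_num
      have hsum : ∑ e, (s + (2 * inner ℝ x (d e) + 2 * ‖d e‖ ^ 2)) ^ (p / 2)
          ≤ N * (5 * D ^ p) := by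
        calc _ ≤ ∑ _e : ε, 5 * D ^ p := Finset.sum_le_sum fun e _ => hle e
          _ = _ := by simp [N]
      have hL : 2⁻¹ * D ^ (p - 2) ≤ (‖x‖ + D) ^ (p - 2) :=
        (hhalf D h0).trans (Real.rpow_le_rpow_of_nonpos (by positivity) (by linarith)
          (by linarith))
      have hDp : D ^ p = D ^ (p - 2) * D ^ 2 := by
        rw [← Real.rpow_natCast, ← Real.rpow_add h0]; congr 1; push_cast; ring
      have h3 : N * (5 * D ^ p) ≤ C * κ * V := by
        rw [hCκ, hDp]
        have hDp0 : 0 ≤ D ^ (p - 2) := Real.rpow_nonneg h0.le _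
        calc N * (5 * (D ^ (p - 2) * D ^ 2)) ≤ 20 * N * 1 * (2⁻¹ * D ^ (p - 2)) * D ^ 2 := by
              have : 0 ≤ N * (D ^ (p - 2) * D ^ 2) := by positivity
              linarith
          _ ≤ _ := by gcongr
      have := Real.rpow_nonneg hs0 (p / 2)
      have : 0 ≤ N * s ^ (p / 2) := by positivity
      linarith
    · have hspos : 0 < s := lt_of_lt_of_le (by positivity) hsD
      have hDs : D ≤ √s := Real.le_sqrt_of_sq_le hsD
      have htan : ∑ e, (s + (2 * inner ℝ x (d e) + 2 * ‖d e‖ ^ 2)) ^ (p / 2)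
          ≤ N * s ^ (p / 2) + p * s ^ (p / 2 - 1) * V := by
        calc _ ≤ ∑ e, (s ^ (p / 2) + p / 2 * s ^ (p / 2 - 1)
                * (2 * inner ℝ x (d e) + 2 * ‖d e‖ ^ 2)) :=
              Finset.sum_le_sum fun e _ =>
                add_rpow_le_tangent hspos (hnn e) (by linarith) (by linarith)
          _ = _ := by
              simp only [Finset.sum_add_distrib, ← Finset.mul_sum, ← inner_sum, hd, ← hV]
              simp [N]; ring
      have hsq : s ^ (p / 2 - 1) = (√s) ^ (p - 2) := by
        rw [Real.sqrt_eq_rpow, ← Real.rpow_mul hs0]; congr 1; ring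
      have hss : 0 < √s := Real.sqrt_pos.2 hspos
      have hL : 2⁻¹ * (√s) ^ (p - 2) ≤ (‖x‖ + D) ^ (p - 2) :=
        (hhalf _ hss).trans (Real.rpow_le_rpow_of_nonpos (by positivity) (by linarith)
          (by linarith))
      have h3 : p * s ^ (p / 2 - 1) * V ≤ C * κ * V := by
        rw [hCκ, hsq]
        have hV0 : 0 ≤ V := (sq_nonneg D).trans hDV
        refine mul_le_mul_of_nonneg_right ?_ hV0
        calc p * (√s) ^ (p - 2) ≤ 20 * 1 * p * (2⁻¹ * (√s) ^ (p - 2)) := by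
              have : 0 ≤ p * (√s) ^ (p - 2) := by positivity
              linarith
          _ ≤ _ := by gcongr
      linarith

/-- With `p = 2 * q`, a step raises `t ^ q` by at most `c * t ^ (q - 1) * ‖d‖ ^ 2 + c * ‖d‖ ^ (2 *
q)`. The mixed term of `U` cancels the first part exactly on average, and the convexity gain of `C *
‖x‖ ^ (2 * q)` cancels the second, which fixes `C`. The outer factor `2` leaves one `t ^ q` to
absorb the mixed term in the majorization. -/
theorem exists_isBellman_of_two_le (ε : Type*) [Fintype ε] [Nonempty ε] {p : ℝ} (hp : 2 ≤ p) :
    ∃ C : ℝ, 0 < C ∧ ∀ (H : Type) [NormedAddCommGroup H] [InnerProductSpace ℝ H],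
      ∃ U, IsBellman H ε p C U := by
  obtain ⟨q, rfl⟩ : ∃ q, p = 2 * q := ⟨p / 2, by ring⟩
  have hq : 1 ≤ q := by linarith
  have hq2 : 2 * q / 2 = q := by ring
  set c : ℝ := q * 2 ^ (q - 1) with hc
  have hc0 : 0 < c := by positivity
  set C : ℝ := c / (2 * 2⁻¹ ^ (2 * q)) with hC
  have hC0 : 0 < C := by positivity
  refine ⟨2 * C + (2 * c) ^ q, by positivity, fun H _ _ => ?_⟩
  have hpow : ∀ x : H, ‖x‖ ^ (2 * q) = (‖x‖ ^ 2) ^ q := fun x => by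
    rw [← sq_rpow_half (norm_nonneg x), hq2]
  refine ⟨fun x t => 2 * (t ^ q - c * (t ^ (q - 1) * ‖x‖ ^ 2) - C * ‖x‖ ^ (2 * q)),
    fun x => ?_, fun x t ht => ?_, fun x t ht d hd => ?_⟩
  · have h1 : 0 ≤ C * ‖x‖ ^ (2 * q) := by positivity
    have h2 : 0 ≤ c * ((0 : ℝ) ^ (q - 1) * ‖x‖ ^ 2) := by positivity
    rw [Real.zero_rpow (by linarith)]
    linarith
  · rw [hq2]
    suffices h : t ^ (q - 1) * (2 * c * ‖x‖ ^ 2) ≤ t ^ q + (2 * c) ^ q * ‖x‖ ^ (2 * q) by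
      linarith
    have h1 : 0 ≤ (2 * c) ^ q * ‖x‖ ^ (2 * q) := by positivity
    have h2 : 0 ≤ t ^ q := by positivity
    have hsplit : ∀ r : ℝ, 0 ≤ r → r ^ (q - 1) * r = r ^ q := fun r hr => by
      rw [← Real.rpow_add_one' hr (by linarith)]; congr 1; ring
    rcases le_total (2 * c * ‖x‖ ^ 2) t with h | h
    · have : t ^ (q - 1) * (2 * c * ‖x‖ ^ 2) ≤ t ^ (q - 1) * t := by gcongr
      rw [hsplit t ht] at this
      linarith
    · have : t ^ (q - 1) * (2 * c * ‖x‖ ^ 2)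
          ≤ (2 * c * ‖x‖ ^ 2) ^ (q - 1) * (2 * c * ‖x‖ ^ 2) := by
        have : 0 ≤ q - 1 := by linarith
        gcongr
      rw [hsplit _ (by positivity), Real.mul_rpow (by positivity) (by positivity),
        ← hpow] at this
      linarith
  · simp only [← Finset.mul_sum]
    suffices h : ∑ e, ((t + ‖d e‖ ^ 2) ^ q
        - c * ((t + ‖d e‖ ^ 2) ^ (q - 1) * ‖x + d e‖ ^ 2) - C * ‖x + d e‖ ^ (2 * q))
        ≤ Fintype.card ε * (t ^ q - c * (t ^ (q - 1) * ‖x‖ ^ 2) - C * ‖x‖ ^ (2 * q)) by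
      linarith
    have key : ∀ e, (t + ‖d e‖ ^ 2) ^ q - c * ((t + ‖d e‖ ^ 2) ^ (q - 1) * ‖x + d e‖ ^ 2)
        ≤ t ^ q + c * (t ^ (q - 1) * ‖d e‖ ^ 2) + c * ‖d e‖ ^ (2 * q)
          - c * (t ^ (q - 1) * ‖x + d e‖ ^ 2) := by
      intro e
      set u := ‖d e‖ ^ 2 with hu
      have hu0 : 0 ≤ u := sq_nonneg _
      have h1 : (t + u) ^ q ≤ t ^ q + q * (t + u) ^ (q - 1) * u := by
        rcases (add_nonneg ht hu0).eq_or_lt with h0 | h0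
        · have : u = 0 := by linarith
          simp [this]
        -- The tangent is taken at the endpoint `t + u`, and evaluated at `t`.
        · have := tangent_le_add_rpow (u := -u) h0 (by linarith) hq
          rw [add_neg_cancel_right] at this
          linarith
      have h2 : (t + u) ^ (q - 1) ≤ 2 ^ (q - 1) * (t ^ (q - 1) + u ^ (q - 1)) :=
        add_rpow_le_two_rpow_mul ht hu0 (by linarith)
      have h3 : q * (t + u) ^ (q - 1) * u
          ≤ q * (2 ^ (q - 1) * (t ^ (q - 1) + u ^ (q - 1))) * u := by gcongr
      have h4 : u ^ (q - 1) * u = ‖d e‖ ^ (2 * q) := by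
        rw [hpow, ← hu, ← Real.rpow_add_one' hu0 (by linarith)]; congr 1; ring
      have h5 : t ^ (q - 1) * ‖x + d e‖ ^ 2 ≤ (t + u) ^ (q - 1) * ‖x + d e‖ ^ 2 := by
        have : 0 ≤ q - 1 := by linarith
        gcongr
        linarith
      have h6 := mul_le_mul_of_nonneg_left h5 hc0.le
      have h7 : q * (2 ^ (q - 1) * (t ^ (q - 1) + u ^ (q - 1))) * u
          = c * (t ^ (q - 1) * u) + c * ‖d e‖ ^ (2 * q) := by rw [← h4, hc]; ring
      linarith
    have hs := Finset.sum_le_sum fun e (_ : e ∈ Finset.univ) => key e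
    have hcl := mul_le_mul_of_nonneg_left (card_mul_norm_rpow_add_sum_le hp hd x) hC0.le
    have hCc : C * (2 * 2⁻¹ ^ (2 * q)) = c := by rw [hC]; field_simp
    simp only [Finset.sum_sub_distrib, Finset.sum_add_distrib, ← Finset.mul_sum,
      sum_norm_add_sq hd x, Finset.sum_const, Finset.card_univ, nsmul_eq_mul] at hs ⊢
    have hcl' : C * (Fintype.card ε * ‖x‖ ^ (2 * q)) + c * ∑ e, ‖d e‖ ^ (2 * q)
        ≤ C * ∑ e, ‖x + d e‖ ^ (2 * q) := by
      rw [← hCc]; linarith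
    linarith

theorem exists_isBellman (ε : Type*) [Fintype ε] [Nonempty ε] {p : ℝ} (hp : 1 < p) :
    ∃ C : ℝ, 0 < C ∧ ∀ (H : Type) [NormedAddCommGroup H] [InnerProductSpace ℝ H],
      ∃ U, IsBellman H ε p C U := by
  rcases le_total p 2 with h | h
  · refine ⟨40 * Fintype.card ε / (p - 1), ?_, fun H _ _ => ⟨_, isBellman_of_le_two H ε hp h⟩⟩
    have : (0 : ℝ) < Fintype.card ε := by exact_mod_cast Fintype.card_pos
    have : 0 < p - 1 := by linarith
    positivity
  · exact exists_isBellman_of_two_le ε h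

end Bellman

/-! ### Square functions of martingales on a homogeneous tree -/

section Discrete

variable {ι ε : Type}

/-- The parent of a vertex, when `c (n, e)` is the `e`-th child of `n`. -/
def parent (c : ι × ε ≃ ι) (n : ι) : ι := (c.symm n).1

@[simp] theorem parent_child (c : ι × ε ≃ ι) (n : ι) (e : ε) : parent c (c (n, e)) = n := by
  simp [parent]

variable {H : Type} [NormedAddCommGroup H]

/-- The square of the square function, `∑ ‖F (j+1) - F j‖²` along the ancestors of a vertex. -/
def sqFun (c : ι × ε ≃ ι) (F : ℕ → ι → H) : ℕ → ι → ℝ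
  | 0, _ => 0
  | J + 1, n => sqFun c F J (parent c n) + ‖F (J + 1) n - F J (parent c n)‖ ^ 2

theorem sqFun_nonneg (c : ι × ε ≃ ι) (F : ℕ → ι → H) (J : ℕ) (n : ι) : 0 ≤ sqFun c F J n := by
  induction J generalizing n with
  | zero => exact le_rfl
  | succ J ih => exact add_nonneg (ih _) (sq_nonneg _)

theorem sqFun_eq_sum (c : ι × ε ≃ ι) (F : ℕ → ι → H) (J : ℕ) (n : ι) :
    sqFun c F J n = ∑ j ∈ Finset.range J,
      ‖F (j + 1) ((parent c)^[J - 1 - j] n) - F j ((parent c)^[J - j] n)‖ ^ 2 := by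
  induction J generalizing n with
  | zero => simp [sqFun]
  | succ J ih =>
    rw [sqFun, ih, Finset.sum_range_succ]
    congr 1
    · refine Finset.sum_congr rfl fun j hj => ?_
      have hj' := Finset.mem_range.1 hj
      have h1 : J + 1 - 1 - j = (J - 1 - j) + 1 := by omega
      have h2 : J + 1 - j = (J - j) + 1 := by omega
      rw [h1, h2, Function.iterate_succ_apply, Function.iterate_succ_apply]
    · simp

variable [InnerProductSpace ℝ H]

/-- The bracket `∑ ⟪F (j+1) - F j, G (j+1) - G j⟫` along the ancestors of a vertex. -/
def bracket (c : ι × ε ≃ ι) (F G : ℕ → ι → H) : ℕ → ι → ℝ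
  | 0, _ => 0
  | J + 1, n => bracket c F G J (parent c n)
      + inner ℝ (F (J + 1) n - F J (parent c n)) (G (J + 1) n - G J (parent c n))

/-- Cauchy–Schwarz along the ancestors, added one generation at a time. -/
theorem bracket_le (c : ι × ε ≃ ι) (F G : ℕ → ι → H) (J : ℕ) (n : ι) :
    bracket c F G J n ≤ √(sqFun c F J n) * √(sqFun c G J n) := by
  induction J generalizing n with
  | zero => simp [bracket, sqFun]
  | succ J ih =>
    rw [bracket, sqFun, sqFun]
    set s := sqFun c F J (parent c n) with hs
    set t := sqFun c G J (parent c n) with ht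
    have hs0 : 0 ≤ s := sqFun_nonneg _ _ _ _
    have ht0 : 0 ≤ t := sqFun_nonneg _ _ _ _
    have h1 := ih (parent c n)
    rw [← hs, ← ht] at h1
    set a := F (J + 1) n - F J (parent c n)
    set b := G (J + 1) n - G J (parent c n)
    have h2 := real_inner_le_norm a b
    refine (add_le_add h1 h2).trans ?_
    rw [← Real.sqrt_mul (by positivity) (t + ‖b‖ ^ 2)]
    apply Real.le_sqrt_of_sq_le
    have e1 := Real.sq_sqrt hs0
    have e2 := Real.sq_sqrt ht0
    have e3 := sq_nonneg (√s * ‖b‖ - √t * ‖a‖)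
    calc (√s * √t + ‖a‖ * ‖b‖) ^ 2
        ≤ (√s ^ 2 + ‖a‖ ^ 2) * (√t ^ 2 + ‖b‖ ^ 2) := by nlinarith
      _ = _ := by rw [e1, e2]

variable [Fintype ε]

/-- The average over the children of a vertex. -/
def childAvg {V : Type} [AddCommGroup V] [Module ℝ V] (c : ι × ε ≃ ι) :
    (ι → V) →ₗ[ℝ] (ι → V) where
  toFun g n := (Fintype.card ε : ℝ)⁻¹ • ∑ e, g (c (n, e))
  map_add' f g := by ext n; simp [Finset.sum_add_distrib]
  map_smul' r g := by
    ext n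
    simp only [Pi.smul_apply, ← Finset.smul_sum, RingHom.id_apply]
    rw [smul_comm]

theorem childAvg_apply {V : Type} [AddCommGroup V] [Module ℝ V] (c : ι × ε ≃ ι) (g : ι → V)
    (n : ι) : childAvg c g n = (Fintype.card ε : ℝ)⁻¹ • ∑ e, g (c (n, e)) := rfl

theorem childAvg_mono (c : ι × ε ≃ ι) {f g : ι → ℝ} (h : f ≤ g) :
    childAvg c f ≤ childAvg c g := fun n => by
  simp only [childAvg_apply, smul_eq_mul]
  gcongr
  exact h _

theorem childAvg_pow_mono (c : ι × ε ≃ ι) (J : ℕ) {f g : ι → ℝ} (h : f ≤ g) :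
    (childAvg c ^ J) f ≤ (childAvg c ^ J) g := by
  induction J with
  | zero => simpa using h
  | succ J ih => simpa only [pow_succ', Module.End.mul_apply] using childAvg_mono c ih

/-- Every vertex is a child of exactly one vertex, because `c` is a bijection; averaging therefore
only divides the total by the branching number. -/
theorem tsum_ofReal_childAvg [Nonempty ε] (c : ι × ε ≃ ι) {g : ι → ℝ} (hg : 0 ≤ g) :
    ∑' n, ENNReal.ofReal (childAvg c g n)
      = (Fintype.card ε : ℝ≥0∞)⁻¹ * ∑' n, ENNReal.ofReal (g n) := by
  rw [← c.tsum_eq (fun n => ENNReal.ofReal (g n)),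
    ENNReal.tsum_prod (f := fun n e => ENNReal.ofReal (g (c (n, e)))), ← ENNReal.tsum_mul_left]
  congr 1 with n
  rw [childAvg_apply, smul_eq_mul, ENNReal.ofReal_mul (by positivity),
    ENNReal.ofReal_sum_of_nonneg fun e _ => hg _, tsum_fintype,
    ENNReal.ofReal_inv_of_pos (by exact_mod_cast Fintype.card_pos), ENNReal.ofReal_natCast]

theorem tsum_ofReal_childAvg_pow [Nonempty ε] (c : ι × ε ≃ ι) (J : ℕ) {g : ι → ℝ} (hg : 0 ≤ g) :
    ∑' n, ENNReal.ofReal ((childAvg c ^ J) g n)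
      = ((Fintype.card ε : ℝ≥0∞)⁻¹) ^ J * ∑' n, ENNReal.ofReal (g n) := by
  induction J with
  | zero => simp
  | succ J ih =>
    have h0 : 0 ≤ (childAvg c ^ J) g := by simpa using childAvg_pow_mono c J hg
    rw [pow_succ', Module.End.mul_apply, tsum_ofReal_childAvg c h0, ih, pow_succ', mul_assoc]

/-- A bound between averages over the descendants of each vertex sums up to a global bound. -/
theorem tsum_le_of_childAvg_pow_le [Nonempty ε] (c : ι × ε ≃ ι) (J : ℕ) {f g : ι → ℝ}
    (hf : 0 ≤ f) (hg : 0 ≤ g) {C : ℝ} (hC : 0 ≤ C)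
    (h : (childAvg c ^ J) f ≤ C • (childAvg c ^ J) g) :
    ∑' n, ENNReal.ofReal (f n) ≤ ENNReal.ofReal C * ∑' n, ENNReal.ofReal (g n) := by
  have h1 : ∑' n, ENNReal.ofReal ((childAvg c ^ J) f n)
      ≤ ENNReal.ofReal C * ∑' n, ENNReal.ofReal ((childAvg c ^ J) g n) := by
    rw [← ENNReal.tsum_mul_left]
    refine ENNReal.tsum_le_tsum fun n => ?_
    rw [← ENNReal.ofReal_mul hC]
    exact ENNReal.ofReal_le_ofReal (h n)
  rw [tsum_ofReal_childAvg_pow c J hf, tsum_ofReal_childAvg_pow c J hg, mul_left_comm] at h1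
  have hN0 : ((Fintype.card ε : ℝ≥0∞)⁻¹) ^ J ≠ 0 := by simp
  have hNt : ((Fintype.card ε : ℝ≥0∞)⁻¹) ^ J ≠ ∞ := by
    refine ENNReal.pow_ne_top (ENNReal.inv_ne_top.2 ?_)
    simp
  exact (ENNReal.mul_le_mul_iff_right hN0 hNt).1 h1


/-- `F 0, …, F J` is a martingale: the value at a vertex is the average over its children. -/
def IsTreeMart (c : ι × ε ≃ ι) (J : ℕ) (F : ℕ → ι → H) : Prop :=
  ∀ j < J, F j = childAvg c (F (j + 1))

variable [Nonempty ε]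

theorem IsTreeMart.sum_sub {c : ι × ε ≃ ι} {J : ℕ} {F : ℕ → ι → H} (hF : IsTreeMart c J F)
    {j : ℕ} (hj : j < J) (n : ι) : ∑ e, (F (j + 1) (c (n, e)) - F j n) = 0 := by
  have hN : (Fintype.card ε : ℝ) ≠ 0 := by exact_mod_cast Fintype.card_ne_zero
  rw [Finset.sum_sub_distrib, hF j hj, childAvg_apply, Finset.sum_const, Finset.card_univ,
    ← Nat.cast_smul_eq_nsmul ℝ, smul_inv_smul₀ hN, sub_self]

/-- The supermartingale argument: averaging over the last generation replaces `U` at stage `j + 1`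
by at most `U` at stage `j`, down to `U x 0 ≤ 0`. -/
theorem childAvg_pow_bellman_le {c : ι × ε ≃ ι} {J : ℕ} {F : ℕ → ι → H}
    (hF : IsTreeMart c J F) {p C : ℝ} {U : H → ℝ → ℝ} (hU : IsBellman H ε p C U) :
    ∀ j ≤ J, (childAvg c ^ j) (fun n => U (F j n) (sqFun c F j n)) ≤ 0 := by
  intro j
  induction j with
  | zero => intro _ n; simpa [sqFun] using hU.zero _
  | succ j ih =>
    intro hj
    rw [pow_succ, Module.End.mul_apply]
    refine (childAvg_pow_mono c j fun n => ?_).trans (ih (by omega))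
    have h := hU.step (F j n) (sqFun c F j n) (sqFun_nonneg _ _ _ _) _ (hF.sum_sub hj n)
    simp only [add_sub_cancel] at h
    have hN : (0 : ℝ) < Fintype.card ε := by exact_mod_cast Fintype.card_pos
    rw [childAvg_apply, smul_eq_mul, inv_mul_le_iff₀ hN]
    simpa [sqFun] using h

/-- The upper square function estimate, averaged over the descendants of any vertex. -/
theorem childAvg_pow_sqFun_le {c : ι × ε ≃ ι} {J : ℕ} {F : ℕ → ι → H}
    (hF : IsTreeMart c J F) {p C : ℝ} {U : H → ℝ → ℝ} (hU : IsBellman H ε p C U) :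
    (childAvg c ^ J) (fun n => sqFun c F J n ^ (p / 2))
      ≤ C • (childAvg c ^ J) (fun n => ‖F J n‖ ^ p) := by
  have h1 : (fun n => sqFun c F J n ^ (p / 2))
      ≤ C • (fun n => ‖F J n‖ ^ p) + fun n => U (F J n) (sqFun c F J n) :=
    fun n => hU.rpow_le _ _ (sqFun_nonneg _ _ _ _)
  have h2 := childAvg_pow_mono c J h1
  rw [map_add, map_smul] at h2
  refine h2.trans ?_
  simpa using childAvg_pow_bellman_le hF hU J le_rfl

/-- Martingale increments are orthogonal to the past, so only products of increments of the same
generation survive averaging; the start contributes nothing since `F 0 = 0`. -/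
theorem childAvg_pow_inner {c : ι × ε ≃ ι} {J : ℕ} {F G : ℕ → ι → H}
    (hF : IsTreeMart c J F) (hG : IsTreeMart c J G) (h0 : ∀ n, F 0 n = 0) :
    ∀ j ≤ J, (childAvg c ^ j) (fun n => inner ℝ (F j n) (G j n))
      = (childAvg c ^ j) (bracket c F G j) := by
  intro j hj
  rw [← sub_eq_zero, ← map_sub]
  induction j with
  | zero => ext n; simp [bracket, h0]
  | succ j ih =>
    rw [pow_succ, Module.End.mul_apply, ← ih (by omega)]
    congr 1
    ext n
    have hN : (Fintype.card ε : ℝ) ≠ 0 := by exact_mod_cast Fintype.card_ne_zero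
    have hterm : ∀ e, inner ℝ (F (j + 1) (c (n, e))) (G (j + 1) (c (n, e)))
        - bracket c F G (j + 1) (c (n, e))
        = inner ℝ (F j n) (G j n) - bracket c F G j n
          + inner ℝ (F (j + 1) (c (n, e)) - F j n) (G j n)
          + inner ℝ (F j n) (G (j + 1) (c (n, e)) - G j n) := by
      intro e
      simp only [bracket, parent_child, inner_sub_left, inner_sub_right]
      ring
    simp only [childAvg_apply, Pi.sub_apply, hterm, Finset.sum_add_distrib, ← inner_sum,
      ← sum_inner, hF.sum_sub (by omega : j < J), hG.sum_sub (by omega : j < J)]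
    simp only [Finset.sum_const, Finset.card_univ, nsmul_eq_mul, smul_eq_mul,
      inner_zero_left, inner_zero_right, add_zero]
    field_simp

theorem norm_rpow_smul_self (x : H) {p : ℝ} (hp : 1 < p) :
    ‖‖x‖ ^ (p - 2) • x‖ = ‖x‖ ^ (p - 1) := by
  rcases eq_or_ne x 0 with rfl | hx
  · simp [Real.zero_rpow (by linarith : p - 1 ≠ 0)]
  · rw [norm_smul, Real.norm_of_nonneg (by positivity), ← Real.rpow_add_one (by simpa)]
    congr 1; ring

/-- The lower square function estimate for a martingale starting at `0`. -/
theorem childAvg_pow_norm_le {p r C : ℝ} (hpr : p.HolderConjugate r) (hC : 0 < C)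
    (hB : ∃ U, IsBellman H ε r C U)
    {c : ι × ε ≃ ι} {J : ℕ} {F : ℕ → ι → H}
    (hF : IsTreeMart c J F) (h0 : ∀ n, F 0 n = 0) :
    (childAvg c ^ J) (fun n => ‖F J n‖ ^ p)
      ≤ (2 * (2 * C + 1) ^ p) • (childAvg c ^ J) (fun n => sqFun c F J n ^ (p / 2)) := by
  obtain ⟨U, hU⟩ := hB
  have hp := hpr.lt
  have hr := hpr.symm.lt
  -- The dual extremizer: its inner product with `F J` and its norm to the power `r` both equal `‖F
  -- J‖ ^ p`. `G` is the martingale that it generates.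
  set g : ι → H := fun n => ‖F J n‖ ^ (p - 2) • F J n with hg
  set G : ℕ → ι → H := fun j => (childAvg c ^ (J - j)) g with hGdef
  have hGJ : G J = g := by simp [hGdef]
  have hG : IsTreeMart c J G := by
    intro j hj
    have : J - j = (J - (j + 1)) + 1 := by omega
    simp only [hGdef, this, pow_succ', Module.End.mul_apply]
  have hgn : ∀ n, ‖G J n‖ ^ r = ‖F J n‖ ^ p := by
    intro n
    rw [hGJ, hg, norm_rpow_smul_self _ hp, ← Real.rpow_mul (norm_nonneg _)]
    rw [hpr.sub_one_mul_conj]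
  have hin : ∀ n, inner ℝ (F J n) (G J n) = ‖F J n‖ ^ p := by
    intro n
    rw [hGJ, hg, inner_smul_right, real_inner_self_eq_norm_sq]
    rcases eq_or_ne (F J n) 0 with hx | hx
    · simp [hx, Real.zero_rpow (by linarith : p ≠ 0)]
    · rw [← Real.rpow_natCast, ← Real.rpow_add (by simpa)]; congr 1; push_cast; ring
  -- The weight for Young's inequality, small enough that the term in the square function of `G`
  -- costs at most half of the left side, where it is absorbed. All averages are finite real
  -- numbers, so this is legitimate.
  set l : ℝ := (2 * C + 1)⁻¹ with hl
  have hl0 : 0 < l := by positivity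
  have hl1 : l ≤ 1 := inv_le_one_of_one_le₀ (by linarith)
  have hlr : l ^ r * C ≤ 2⁻¹ := by
    have h1 : l ^ r ≤ l := by
      simpa using Real.rpow_le_rpow_of_exponent_ge hl0 hl1 hr.le
    calc l ^ r * C ≤ l * C := by gcongr
      _ ≤ 2⁻¹ := by
        rw [hl, inv_mul_eq_div, div_le_iff₀ (by positivity)]; linarith
  have key : (fun n => ‖F J n‖ ^ p) = (fun n => inner ℝ (F J n) (G J n)) := by
    ext n; rw [hin]
  have hyoung : bracket c F G J ≤ ((2 * C + 1) ^ p) • (fun n => sqFun c F J n ^ (p / 2))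
      + (l ^ r) • (fun n => sqFun c G J n ^ (r / 2)) := by
    intro n
    refine (bracket_le c F G J n).trans ?_
    have hs := sqFun_nonneg c F J n
    have ht := sqFun_nonneg c G J n
    have hy := Real.young_inequality_of_nonneg
      (a := (2 * C + 1) * √(sqFun c F J n)) (b := l * √(sqFun c G J n))
      (by positivity) (by positivity) hpr
    have e1 : (2 * C + 1) * √(sqFun c F J n) * (l * √(sqFun c G J n))
        = √(sqFun c F J n) * √(sqFun c G J n) := by
      rw [hl]; field_simp
    have e2 : ∀ s : ℝ, 0 ≤ s → ∀ p : ℝ, √s ^ p = s ^ (p / 2) := fun s hs p => by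
      rw [Real.sqrt_eq_rpow, ← Real.rpow_mul hs]; congr 1; ring
    rw [e1, Real.mul_rpow (by positivity) (by positivity),
      Real.mul_rpow (by positivity) (by positivity), e2 _ hs, e2 _ ht] at hy
    refine hy.trans (add_le_add ?_ ?_)
    · exact div_le_self (by positivity) hp.le
    · exact div_le_self (by positivity) hr.le
  have hup := childAvg_pow_sqFun_le hG hU
  have hmain := childAvg_pow_mono c J hyoung
  rw [← childAvg_pow_inner hF hG h0 J le_rfl, ← key, map_add, map_smul, map_smul] at hmain
  simp only [hgn] at hup
  intro n
  have h1 := hmain n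
  have h2 := hup n
  have h3 : (0 : ι → ℝ) ≤ (childAvg c ^ J) (fun n => ‖F J n‖ ^ p) := by
    simpa using childAvg_pow_mono c J
      (show (0 : ι → ℝ) ≤ fun n => ‖F J n‖ ^ p from fun n => by simp; positivity)
  have h4 := h3 n
  simp only [Pi.add_apply, Pi.smul_apply, smul_eq_mul, Pi.zero_apply] at h1 h2 h4 ⊢
  have h5 := mul_le_mul_of_nonneg_left h2 (by positivity : 0 ≤ l ^ r)
  have h6 := mul_le_mul_of_nonneg_right hlr h4
  linarith

/-- The two-sided one-parameter square function estimates for Hilbert space valued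
martingales on a homogeneous tree, with constants depending only on `p` and the branching. -/
theorem exists_tsum_sqFun_bounds (ε : Type) [Fintype ε] [Nonempty ε] {p : ℝ} (hp : 1 < p) :
    ∃ C : ℝ, 0 < C ∧ ∀ (ι : Type) (c : ι × ε ≃ ι) (H : Type) [NormedAddCommGroup H]
      [InnerProductSpace ℝ H] (J : ℕ) (F : ℕ → ι → H), IsTreeMart c J F →
      ∑' n, ENNReal.ofReal (sqFun c F J n ^ (p / 2))
        ≤ ENNReal.ofReal C * ∑' n, ENNReal.ofReal (‖F J n‖ ^ p) ∧
      ∑' n, ENNReal.ofReal (‖F J n - F 0 ((parent c)^[J] n)‖ ^ p)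
        ≤ ENNReal.ofReal C * ∑' n, ENNReal.ofReal (sqFun c F J n ^ (p / 2)) := by
  have hpr : p.HolderConjugate p.conjExponent := .conjExponent hp
  obtain ⟨C₁, hC₁, h₁⟩ := exists_isBellman ε hp
  obtain ⟨C₂, hC₂, h₂⟩ := exists_isBellman ε hpr.symm.lt
  refine ⟨max C₁ (2 * (2 * C₂ + 1) ^ p), lt_max_of_lt_left hC₁, fun ι c H _ _ J F hF => ⟨?_, ?_⟩⟩
  · obtain ⟨U, hU⟩ := h₁ H
    refine (tsum_le_of_childAvg_pow_le c J
      (fun n => Real.rpow_nonneg (sqFun_nonneg c F J n) _)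
      (fun n => Real.rpow_nonneg (norm_nonneg _) _) hC₁.le
      (childAvg_pow_sqFun_le hF hU)).trans ?_
    gcongr
    exact le_max_left _ _
  -- Subtracting the value at the generation `0` ancestor gives a martingale starting at `0` with
  -- the same increments.
  · set F' : ℕ → ι → H := fun j n => F j n - F 0 ((parent c)^[j] n) with hF'
    have hm : IsTreeMart c J F' := by
      intro j hj
      ext n
      have hN : (Fintype.card ε : ℝ) ≠ 0 := by exact_mod_cast Fintype.card_ne_zero
      simp only [hF', hF j hj, childAvg_apply, Function.iterate_succ_apply, parent_child,
        Finset.sum_sub_distrib, Finset.sum_const, Finset.card_univ, smul_sub]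
      rw [← Nat.cast_smul_eq_nsmul ℝ, inv_smul_smul₀ hN]
    have hs : ∀ j n, sqFun c F' j n = sqFun c F j n := by
      intro j
      induction j with
      | zero => intro n; rfl
      | succ j ih =>
        intro n
        rw [sqFun, sqFun, ih]
        simp [hF']
    have := tsum_le_of_childAvg_pow_le c J
      (fun n => Real.rpow_nonneg (norm_nonneg _) _)
      (fun n => Real.rpow_nonneg (sqFun_nonneg c F' J n) _) (by positivity)
      (childAvg_pow_norm_le hpr hC₂ (h₂ H) hm (by simp [hF']))
    simp only [hs] at this
    refine this.trans ?_
    gcongr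
    exact le_max_right _ _

/-- The square of the truncated bi-parameter square function. -/
def biSq (c : ι × ε ≃ ι) (a : ℕ → ℕ → ι → ι → ℂ) (J : ℕ) (n₁ n₂ : ι) : ℝ :=
  ∑ j ∈ Finset.range J, ∑ i ∈ Finset.range J,
    ‖(a (i + 1) (j + 1) ((parent c)^[J - 1 - i] n₁) ((parent c)^[J - 1 - j] n₂)
        - a i (j + 1) ((parent c)^[J - i] n₁) ((parent c)^[J - 1 - j] n₂))
      - (a (i + 1) j ((parent c)^[J - 1 - i] n₁) ((parent c)^[J - j] n₂)
        - a i j ((parent c)^[J - i] n₁) ((parent c)^[J - j] n₂))‖ ^ 2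

/-- Each direction applies the one-parameter estimate once to the vector-valued martingale `F n₁` in
`n₂` and once to a scalar martingale in `n₁`, hence the constant `C * C`. -/
theorem exists_tsum_biSq_bounds (ε : Type) [Fintype ε] [Nonempty ε] {p : ℝ} (hp : 1 < p) :
    ∃ C : ℝ, 0 < C ∧ ∀ (ι : Type) (c : ι × ε ≃ ι) (J : ℕ) (a : ℕ → ℕ → ι → ι → ℂ),
      (∀ j n₂, IsTreeMart c J fun i n₁ => a i j n₁ n₂) →
      (∀ i n₁, IsTreeMart c J fun j n₂ => a i j n₁ n₂) →
      ∑' n₁, ∑' n₂, ENNReal.ofReal (biSq c a J n₁ n₂ ^ (p / 2))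
        ≤ ENNReal.ofReal C * ∑' n₁, ∑' n₂, ENNReal.ofReal (‖a J J n₁ n₂‖ ^ p) ∧
      ∑' n₁, ∑' n₂, ENNReal.ofReal (‖(a J J n₁ n₂ - a J 0 n₁ ((parent c)^[J] n₂))
          - (a 0 J ((parent c)^[J] n₁) n₂ - a 0 0 ((parent c)^[J] n₁) ((parent c)^[J] n₂))‖ ^ p)
        ≤ ENNReal.ofReal C * ∑' n₁, ∑' n₂, ENNReal.ofReal (biSq c a J n₁ n₂ ^ (p / 2)) := by
  obtain ⟨C, hC, h⟩ := exists_tsum_sqFun_bounds ε hp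
  refine ⟨C * C, by positivity, fun ι c J a h₁ h₂ => ?_⟩
  set F : ι → ℕ → ι → EuclideanSpace ℂ (Fin J) := fun n₁ j n₂ =>
    WithLp.toLp 2 fun i : Fin J => a (i + 1) j ((parent c)^[J - 1 - i] n₁) n₂
      - a i j ((parent c)^[J - i] n₁) n₂ with hF
  have hFm : ∀ n₁, IsTreeMart c J (F n₁) := by
    intro n₁ j hj
    ext n₂ i
    have e1 := congrFun (h₂ (i + 1) ((parent c)^[J - 1 - i] n₁) j hj) n₂
    have e2 := congrFun (h₂ i ((parent c)^[J - i] n₁) j hj) n₂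
    simp only [childAvg_apply] at e1 e2
    simp [hF, childAvg_apply, e1, e2, mul_sub]
  have hFsq : ∀ n₁ n₂, sqFun c (F n₁) J n₂ = biSq c a J n₁ n₂ := by
    intro n₁ n₂
    rw [sqFun_eq_sum, biSq]
    refine Finset.sum_congr rfl fun j _ => ?_
    rw [EuclideanSpace.norm_sq_eq, ← Fin.sum_univ_eq_sum_range (fun i =>
      ‖(a (i + 1) (j + 1) ((parent c)^[J - 1 - i] n₁) ((parent c)^[J - 1 - j] n₂)
        - a i (j + 1) ((parent c)^[J - i] n₁) ((parent c)^[J - 1 - j] n₂))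
      - (a (i + 1) j ((parent c)^[J - 1 - i] n₁) ((parent c)^[J - j] n₂)
        - a i j ((parent c)^[J - i] n₁) ((parent c)^[J - j] n₂))‖ ^ 2)]
    rfl
  rw [ENNReal.ofReal_mul hC.le]
  constructor
  · have hFJ : ∀ n₁ n₂, ‖F n₁ J n₂‖ ^ p
        = sqFun c (fun i n₁ => a i J n₁ n₂) J n₁ ^ (p / 2) := by
      intro n₁ n₂
      rw [← sq_rpow_half (norm_nonneg _), EuclideanSpace.norm_sq_eq, sqFun_eq_sum,
        ← Fin.sum_univ_eq_sum_range (fun i => ‖a (i + 1) J ((parent c)^[J - 1 - i] n₁) n₂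
          - a i J ((parent c)^[J - i] n₁) n₂‖ ^ 2)]
    calc ∑' n₁, ∑' n₂, ENNReal.ofReal (biSq c a J n₁ n₂ ^ (p / 2))
        ≤ ∑' n₁, ENNReal.ofReal C * ∑' n₂, ENNReal.ofReal (‖F n₁ J n₂‖ ^ p) := by
          refine ENNReal.tsum_le_tsum fun n₁ => ?_
          simpa only [hFsq] using (h ι c _ J (F n₁) (hFm n₁)).1
      _ = ENNReal.ofReal C * ∑' n₂, ∑' n₁,
            ENNReal.ofReal (sqFun c (fun i n₁ => a i J n₁ n₂) J n₁ ^ (p / 2)) := by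
          rw [ENNReal.tsum_mul_left, ENNReal.tsum_comm]; simp only [hFJ]
      _ ≤ ENNReal.ofReal C * ∑' n₂, ENNReal.ofReal C *
            ∑' n₁, ENNReal.ofReal (‖a J J n₁ n₂‖ ^ p) := by
          gcongr with n₂
          exact (h ι c ℂ J _ (h₁ J n₂)).1
      _ = _ := by rw [ENNReal.tsum_mul_left, ENNReal.tsum_comm, mul_assoc]
  -- Removing the starting value of `F n₁` amounts to removing the second-parameter start from `a`,
  -- giving `b`; the lower bound for `b` in `n₁` then removes the other start.
  · set b : ι → ℕ → ι → ℂ := fun n₂ i n₁ => a i J n₁ n₂ - a i 0 n₁ ((parent c)^[J] n₂) with hb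
    have hbm : ∀ n₂, IsTreeMart c J (b n₂) := by
      intro n₂ i hi
      have e1 := h₁ J n₂ i hi
      have e2 := h₁ 0 ((parent c)^[J] n₂) i hi
      have e3 : b n₂ i = (fun n₁ => a i J n₁ n₂) - fun n₁ => a i 0 n₁ ((parent c)^[J] n₂) := rfl
      rw [e3]
      simp only at e1 e2
      rw [e1, e2, ← map_sub]
      rfl
    have hFJ : ∀ n₁ n₂, ‖F n₁ J n₂ - F n₁ 0 ((parent c)^[J] n₂)‖ ^ p
        = sqFun c (b n₂) J n₁ ^ (p / 2) := by
      intro n₁ n₂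
      rw [← sq_rpow_half (norm_nonneg _), EuclideanSpace.norm_sq_eq, sqFun_eq_sum,
        ← Fin.sum_univ_eq_sum_range (fun i => ‖b n₂ (i + 1) ((parent c)^[J - 1 - i] n₁)
          - b n₂ i ((parent c)^[J - i] n₁)‖ ^ 2)]
      congr 1
      refine Finset.sum_congr rfl fun i _ => ?_
      simp only [hF, hb, PiLp.sub_apply]
      congr 2
      ring
    calc _ ≤ ∑' n₂, ENNReal.ofReal C *
            ∑' n₁, ENNReal.ofReal (sqFun c (b n₂) J n₁ ^ (p / 2)) := by
          rw [ENNReal.tsum_comm]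
          exact ENNReal.tsum_le_tsum fun n₂ => (h ι c ℂ J _ (hbm n₂)).2
      _ = ENNReal.ofReal C * ∑' n₁, ∑' n₂,
            ENNReal.ofReal (‖F n₁ J n₂ - F n₁ 0 ((parent c)^[J] n₂)‖ ^ p) := by
          rw [ENNReal.tsum_mul_left, ENNReal.tsum_comm]; simp only [hFJ]
      _ ≤ ENNReal.ofReal C * ∑' n₁, ENNReal.ofReal C *
            ∑' n₂, ENNReal.ofReal (biSq c a J n₁ n₂ ^ (p / 2)) := by
          gcongr with n₁
          simpa only [hFsq] using (h ι c _ J (F n₁) (hFm n₁)).2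
      _ = _ := by rw [ENNReal.tsum_mul_left, mul_assoc]

end Discrete

/-! ### Dyadic cubes as a tree and truncated estimates for the product system -/

section Cubes

variable {m : ℕ}

/-- The index of the dyadic cube of side length `2 ^ (-k)` containing `x`. -/
def cubeIndex (k : ℤ) (x : Rm m) : Fin m → ℤ := fun j => ⌊x j * 2 ^ k⌋

theorem mem_dyadicCube {k : ℤ} {n : Fin m → ℤ} {x : Rm m} :
    x ∈ dyadicCube k n ↔ cubeIndex k x = n := by
  have h2 : (0 : ℝ) < 2 ^ k := by positivity
  simp only [dyadicCube, Set.mem_ofPred_eq, cubeIndex, funext_iff, Int.floor_eq_iff, zpow_neg,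
    ← div_eq_mul_inv, div_le_iff₀ h2, lt_div_iff₀ h2]

/-- The `2 ^ m` children of the index of a dyadic cube. -/
def cubeTree (m : ℕ) : (Fin m → ℤ) × (Fin m → Fin 2) ≃ (Fin m → ℤ) :=
  (Equiv.arrowProdEquivProdArrow (Fin m) (fun _ => ℤ) (fun _ => Fin 2)).symm.trans
    (Equiv.piCongrRight fun _ => (Int.divModEquiv 2).symm)

theorem parent_cubeTree (n : Fin m → ℤ) : parent (cubeTree m) n = fun j => n j / 2 := by
  ext j
  simp [parent, cubeTree, Equiv.arrowProdEquivProdArrow]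

theorem parent_cubeIndex (k : ℤ) (x : Rm m) :
    parent (cubeTree m) (cubeIndex (k + 1) x) = cubeIndex k x := by
  ext j
  rw [parent_cubeTree]
  have := Int.mul_natCast_floor_div_cancel (n := 2) two_ne_zero (x j * 2 ^ k)
  change ⌊x j * 2 ^ (k + 1)⌋ / 2 = ⌊x j * 2 ^ k⌋
  rw [← this, zpow_add_one₀ two_ne_zero, mul_assoc]
  norm_num

theorem iterate_parent_cubeIndex (k : ℤ) (i : ℕ) (x : Rm m) :
    (parent (cubeTree m))^[i] (cubeIndex (k + i) x) = cubeIndex k x := by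
  induction i with
  | zero => simp
  | succ i ih =>
    rw [Function.iterate_succ_apply, Nat.cast_succ, ← add_assoc, parent_cubeIndex, ih]

theorem dyadicCube_eq_iUnion (k : ℤ) (n : Fin m → ℤ) :
    dyadicCube k n = ⋃ e, dyadicCube (k + 1) (cubeTree m (n, e)) := by
  ext x
  simp only [Set.mem_iUnion, mem_dyadicCube]
  constructor
  · rintro rfl
    refine ⟨((cubeTree m).symm (cubeIndex (k + 1) x)).2, ?_⟩
    rw [← parent_cubeIndex k x]
    exact ((cubeTree m).apply_symm_apply (cubeIndex (k + 1) x)).symm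
  · rintro ⟨e, he⟩
    rw [← parent_cubeIndex, he, parent_child]

theorem disjoint_dyadicCube {k : ℤ} {n n' : Fin m → ℤ} (h : n ≠ n') :
    Disjoint (dyadicCube k n) (dyadicCube k n') :=
  Set.disjoint_left.2 fun _ hx hx' => h ((mem_dyadicCube.1 hx).symm.trans (mem_dyadicCube.1 hx'))

theorem dyadicCube_eq_pi (k : ℤ) (n : Fin m → ℤ) :
    dyadicCube k n = Set.univ.pi fun j =>
      Set.Ico ((n j : ℝ) * 2 ^ (-k)) (((n j : ℝ) + 1) * 2 ^ (-k)) := by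
  ext x; simp [dyadicCube]

theorem measurableSet_dyadicCube (k : ℤ) (n : Fin m → ℤ) :
    MeasurableSet (dyadicCube k n : Set (Rm m)) := by
  rw [dyadicCube_eq_pi]
  exact MeasurableSet.univ_pi fun _ => measurableSet_Ico

theorem volume_dyadicCube (k : ℤ) (n : Fin m → ℤ) :
    volume (dyadicCube k n : Set (Rm m)) = ENNReal.ofReal (2 ^ (-k)) ^ m := by
  rw [dyadicCube_eq_pi, Real.volume_pi_Ico]
  have : ∀ j, ((n j : ℝ) + 1) * 2 ^ (-k) - n j * 2 ^ (-k) = 2 ^ (-k) := fun j => by ring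
  simp only [this, Finset.prod_const, Finset.card_univ, Fintype.card_fin]

theorem measurable_cubeIndex (k : ℤ) : Measurable (cubeIndex k : Rm m → Fin m → ℤ) :=
  measurable_pi_iff.2 fun j => ((measurable_pi_apply j).mul_const _).floor

/-- The product of two dyadic cubes, a tile of the first system. -/
def box (k : ℤ × ℤ) (n₁ n₂ : Fin m → ℤ) : Set (Rm m × Rm m) :=
  dyadicCube k.1 n₁ ×ˢ dyadicCube k.2 n₂

/-- The volume of a tile at scale `k`. -/
def boxVol (m : ℕ) (k : ℤ × ℤ) : ℝ≥0∞ :=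
  ENNReal.ofReal (2 ^ (-k.1)) ^ m * ENNReal.ofReal (2 ^ (-k.2)) ^ m

theorem tile_zero (k : ℤ × ℤ) (n : (Fin m → ℤ) × (Fin m → ℤ)) : tile 0 k n = box k n.1 n.2 := rfl

theorem mem_box {k : ℤ × ℤ} {n₁ n₂ : Fin m → ℤ} {x : Rm m × Rm m} :
    x ∈ box k n₁ n₂ ↔ cubeIndex k.1 x.1 = n₁ ∧ cubeIndex k.2 x.2 = n₂ := by
  rw [box, Set.mem_prod, mem_dyadicCube, mem_dyadicCube]

theorem measurableSet_box (k : ℤ × ℤ) (n₁ n₂ : Fin m → ℤ) : MeasurableSet (box k n₁ n₂) :=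
  (measurableSet_dyadicCube _ _).prod (measurableSet_dyadicCube _ _)

theorem volume_box (k : ℤ × ℤ) (n₁ n₂ : Fin m → ℤ) : volume (box k n₁ n₂) = boxVol m k := by
  rw [box, Measure.volume_eq_prod, Measure.prod_prod, volume_dyadicCube, volume_dyadicCube, boxVol]

theorem boxVol_ne_zero (k : ℤ × ℤ) : boxVol m k ≠ 0 := by
  have h : ∀ k : ℤ, ENNReal.ofReal (2 ^ (-k)) ≠ 0 := fun k => by
    simpa using (by positivity : (0 : ℝ) < 2 ^ k)
  exact mul_ne_zero (pow_ne_zero _ (h _)) (pow_ne_zero _ (h _))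

theorem boxVol_ne_top (k : ℤ × ℤ) : boxVol m k ≠ ∞ :=
  ENNReal.mul_ne_top (ENNReal.pow_ne_top ENNReal.ofReal_ne_top)
    (ENNReal.pow_ne_top ENNReal.ofReal_ne_top)

/-- The average of `f` over a tile of the first system. -/
def coef (f : Rm m × Rm m → ℂ) (k : ℤ × ℤ) (n₁ n₂ : Fin m → ℤ) : ℂ := ⨍ y in box k n₁ n₂, f y

theorem expect_zero_apply (k : ℤ × ℤ) (f : Rm m × Rm m → ℂ) (x : Rm m × Rm m) :
    expect 0 k f x = coef f k (cubeIndex k.1 x.1) (cubeIndex k.2 x.2) := by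
  rw [expect, tsum_eq_single (cubeIndex k.1 x.1, cubeIndex k.2 x.2)]
  · rw [tile_zero, Set.indicator_of_mem (mem_box.2 ⟨rfl, rfl⟩), coef]
  · intro n hn
    refine Set.indicator_of_notMem (fun hx => hn ?_) _
    rw [tile_zero, mem_box] at hx
    exact Prod.ext hx.1.symm hx.2.symm

theorem measurable_comp_cubeIndex {β : Type*} [MeasurableSpace β]
    (g : (Fin m → ℤ) → (Fin m → ℤ) → β) (k : ℤ × ℤ) :
    Measurable fun x : Rm m × Rm m => g (cubeIndex k.1 x.1) (cubeIndex k.2 x.2) :=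
  (measurable_of_countable (fun n : (Fin m → ℤ) × (Fin m → ℤ) => g n.1 n.2)).comp
    (((measurable_cubeIndex k.1).comp measurable_fst).prodMk
      ((measurable_cubeIndex k.2).comp measurable_snd))

theorem measurable_expect_zero (k : ℤ × ℤ) (f : Rm m × Rm m → ℂ) : Measurable (expect 0 k f) := by
  rw [funext (expect_zero_apply k f)]
  exact measurable_comp_cubeIndex _ k

theorem measurable_mdiff_zero (k : ℤ × ℤ) (f : Rm m × Rm m → ℂ) : Measurable (mdiff 0 k f) :=
  ((measurable_expect_zero _ f).sub (measurable_expect_zero _ f)).sub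
    ((measurable_expect_zero _ f).sub (measurable_expect_zero _ f))

theorem lintegral_comp_cubeIndex (g : (Fin m → ℤ) → (Fin m → ℤ) → ℝ≥0∞) (k : ℤ × ℤ) :
    ∫⁻ x : Rm m × Rm m, g (cubeIndex k.1 x.1) (cubeIndex k.2 x.2)
      = boxVol m k * ∑' n₁, ∑' n₂, g n₁ n₂ := by
  have hφ : Measurable fun x : Rm m × Rm m => (cubeIndex k.1 x.1, cubeIndex k.2 x.2) :=
    ((measurable_cubeIndex k.1).comp measurable_fst).prodMk
      ((measurable_cubeIndex k.2).comp measurable_snd)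
  have hg : Measurable fun n : (Fin m → ℤ) × (Fin m → ℤ) => g n.1 n.2 := measurable_of_countable _
  rw [← lintegral_map hg hφ, lintegral_countable', ← ENNReal.tsum_prod, ← ENNReal.tsum_mul_left]
  refine tsum_congr fun n => ?_
  rw [Measure.map_apply hφ (measurableSet_singleton n), mul_comm,
    ← volume_box k n.1 n.2]
  congr 2
  ext x
  simp [mem_box, Prod.ext_iff]

theorem lintegral_eq_tsum_box (g : Rm m × Rm m → ℝ≥0∞) (k : ℤ × ℤ) :
    ∫⁻ x, g x = ∑' n₁, ∑' n₂, ∫⁻ x in box k n₁ n₂, g x := by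
  have hU : (⋃ n : (Fin m → ℤ) × (Fin m → ℤ), box k n.1 n.2) = Set.univ :=
    Set.eq_univ_of_forall fun x => Set.mem_iUnion.2
      ⟨(cubeIndex k.1 x.1, cubeIndex k.2 x.2), mem_box.2 ⟨rfl, rfl⟩⟩
  rw [← ENNReal.tsum_prod, ← setLIntegral_univ, ← hU, lintegral_iUnion
    (s := fun n : (Fin m → ℤ) × (Fin m → ℤ) => box k n.1 n.2) (fun n => measurableSet_box k n.1 n.2)]
  intro n n' hn
  refine Set.disjoint_left.2 fun x hx hx' => hn ?_
  rw [mem_box] at hx hx'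
  exact Prod.ext (hx.1.symm.trans hx'.1) (hx.2.symm.trans hx'.2)

/-- Jensen's inequality on a tile. -/
theorem boxVol_mul_coef_rpow_le {f : Rm m × Rm m → ℂ} (hf : AEStronglyMeasurable f volume)
    {p : ℝ} (hp : 1 ≤ p) (k : ℤ × ℤ) (n₁ n₂ : Fin m → ℤ) :
    boxVol m k * ‖coef f k n₁ n₂‖ₑ ^ p ≤ ∫⁻ x in box k n₁ n₂, ‖f x‖ₑ ^ p := by
  set v := boxVol m k with hv
  have hv0 : v ≠ 0 := boxVol_ne_zero k
  have hvt : v ≠ ∞ := boxVol_ne_top k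
  have hp0 : 0 < p := by linarith
  have h1 := eLpNorm_le_eLpNorm_mul_rpow_measure_univ (μ := volume.restrict (box k n₁ n₂))
    (p := 1) (q := ENNReal.ofReal p) (by simpa using hp) hf.restrict
  rw [eLpNorm_one_eq_lintegral_enorm, eLpNorm_eq_lintegral_rpow_enorm_toReal
    (by simpa using hp0) ENNReal.ofReal_ne_top, ENNReal.toReal_ofReal hp0.le,
    Measure.restrict_apply_univ, volume_box, ENNReal.toReal_one, ← hv] at h1
  set A := ∫⁻ x in box k n₁ n₂, ‖f x‖ₑ ^ p
  have h2 : ‖coef f k n₁ n₂‖ₑ ≤ v⁻¹ * (A ^ (1 / p) * v ^ (1 / 1 - 1 / p)) := by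
    rw [coef, setAverage_eq, enorm_smul, Measure.real, volume_box, ← ENNReal.toReal_inv,
      Real.enorm_of_nonneg ENNReal.toReal_nonneg, ENNReal.ofReal_toReal (by simpa using hv0)]
    gcongr
    exact (enorm_integral_le_lintegral_enorm _).trans h1
  calc v * ‖coef f k n₁ n₂‖ₑ ^ p ≤ v * (v⁻¹ * (A ^ (1 / p) * v ^ (1 / 1 - 1 / p))) ^ p := by
        gcongr
    _ = A * (v ^ (1 : ℝ) * (v ^ (-p) * v ^ (p - 1))) := by
        rw [ENNReal.mul_rpow_of_nonneg _ _ hp0.le, ENNReal.mul_rpow_of_nonneg _ _ hp0.le,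
          ← ENNReal.rpow_mul, ← ENNReal.rpow_mul, ← ENNReal.rpow_neg_one, ← ENNReal.rpow_mul,
          ENNReal.rpow_one]
        have e1 : 1 / p * p = 1 := by field_simp
        have e2 : (1 / 1 - 1 / p) * p = p - 1 := by field_simp
        have e3 : -1 * p = -p := by ring
        rw [e1, e2, e3, ENNReal.rpow_one]
        ring
    _ = A := by
        rw [← ENNReal.rpow_add _ _ hv0 hvt, ← ENNReal.rpow_add _ _ hv0 hvt]
        ring_nf
        simp

/-- Equal measures make all weights equal: this is the martingale property of tile averages in
either parameter. -/
theorem average_iUnion_eq {X ε : Type*} [MeasurableSpace X] [Fintype ε] [Nonempty ε]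
    {μ : Measure X} {R : ε → Set X} {v : ℝ≥0∞} (hR : ∀ e, MeasurableSet (R e))
    (hd : Pairwise (Function.onFun Disjoint R)) (hv : ∀ e, μ (R e) = v)
    {f : X → ℂ} (hf : ∀ e, IntegrableOn f (R e) μ) :
    ⨍ x in ⋃ e, R e, f x ∂μ = (Fintype.card ε : ℝ)⁻¹ • ∑ e, ⨍ x in R e, f x ∂μ := by
  simp only [setAverage_eq, Measure.real, hv, measure_iUnion hd hR, tsum_fintype,
    integral_iUnion_fintype hR hd hf, ← Finset.smul_sum, smul_smul]
  congr 1
  simp [mul_comm]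

theorem isTreeMart_coef_left {f : Rm m × Rm m → ℂ} (J : ℕ)
    (hf : ∀ k n₁ n₂, IntegrableOn f (box k n₁ n₂)) (k₀ k : ℤ) (n₂ : Fin m → ℤ) :
    IsTreeMart (cubeTree m) J fun i n₁ => coef f (k₀ + i, k) n₁ n₂ := by
  intro i _
  ext1 n₁
  have hU : box (k₀ + i, k) n₁ n₂
      = ⋃ e, box (k₀ + (i + 1 : ℕ), k) (cubeTree m (n₁, e)) n₂ := by
    simp only [box, ← Set.iUnion_prod_const, dyadicCube_eq_iUnion (k₀ + i), Nat.cast_succ,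
      add_assoc]
  rw [childAvg_apply]
  simp only [coef, hU]
  refine average_iUnion_eq (fun _ => measurableSet_box _ _ _) (fun e e' he => ?_)
    (fun _ => volume_box _ _ _) fun _ => hf _ _ _
  exact Set.disjoint_prod.2 (Or.inl (disjoint_dyadicCube (by simpa using he)))

theorem isTreeMart_coef_right {f : Rm m × Rm m → ℂ} (J : ℕ)
    (hf : ∀ k n₁ n₂, IntegrableOn f (box k n₁ n₂)) (k₀ k : ℤ) (n₁ : Fin m → ℤ) :
    IsTreeMart (cubeTree m) J fun j n₂ => coef f (k, k₀ + j) n₁ n₂ := by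
  intro j _
  ext1 n₂
  have hU : box (k, k₀ + j) n₁ n₂
      = ⋃ e, box (k, k₀ + (j + 1 : ℕ)) n₁ (cubeTree m (n₂, e)) := by
    simp only [box, ← Set.prod_iUnion, dyadicCube_eq_iUnion (k₀ + j), Nat.cast_succ,
      add_assoc]
  rw [childAvg_apply]
  simp only [coef, hU]
  refine average_iUnion_eq (fun _ => measurableSet_box _ _ _) (fun e e' he => ?_)
    (fun _ => volume_box _ _ _) fun _ => hf _ _ _
  exact Set.disjoint_prod.2 (Or.inr (disjoint_dyadicCube (by simpa using he)))

/-- The sum of `|Δ_k f|²` over the scales `k₀ ≤ k₁, k₂ < k₀ + J`. -/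
def truncSq (f : Rm m × Rm m → ℂ) (k₀ : ℤ) (J : ℕ) (x : Rm m × Rm m) : ℝ≥0∞ :=
  ∑ j ∈ Finset.range J, ∑ i ∈ Finset.range J, ‖mdiff 0 (k₀ + i, k₀ + j) f x‖ₑ ^ 2

/-- The sum of `Δ_k f` over the scales `k₀ ≤ k₁, k₂ < k₀ + J`. -/
def truncSum (f : Rm m × Rm m → ℂ) (k₀ : ℤ) (J : ℕ) (x : Rm m × Rm m) : ℂ :=
  (expect 0 (k₀ + J, k₀ + J) f x - expect 0 (k₀ + J, k₀) f x)
    - (expect 0 (k₀, k₀ + J) f x - expect 0 (k₀, k₀) f x)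

theorem truncSq_eq (f : Rm m × Rm m → ℂ) (k₀ : ℤ) (J : ℕ) (x : Rm m × Rm m) :
    truncSq f k₀ J x = ENNReal.ofReal (biSq (cubeTree m)
      (fun i j => coef f (k₀ + i, k₀ + j)) J
      (cubeIndex (k₀ + J) x.1) (cubeIndex (k₀ + J) x.2)) := by
  rw [truncSq, biSq, ENNReal.ofReal_sum_of_nonneg fun _ _ => by positivity]
  refine Finset.sum_congr rfl fun j hj => ?_
  rw [ENNReal.ofReal_sum_of_nonneg fun _ _ => by positivity]
  refine Finset.sum_congr rfl fun i hi => ?_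
  have hpar : ∀ i ∈ Finset.range J, ∀ y : Rm m,
      (parent (cubeTree m))^[J - 1 - i] (cubeIndex (k₀ + J) y) = cubeIndex (k₀ + i + 1) y ∧
      (parent (cubeTree m))^[J - i] (cubeIndex (k₀ + J) y) = cubeIndex (k₀ + i) y := by
    intro i hi y
    have hi' := Finset.mem_range.1 hi
    constructor
    · rw [← iterate_parent_cubeIndex (k₀ + i + 1) (J - 1 - i)]
      congr 2
      omega
    · rw [← iterate_parent_cubeIndex (k₀ + i) (J - i)]
      congr 2
      omega
  rw [(hpar i hi x.1).1, (hpar i hi x.1).2, (hpar j hj x.2).1, (hpar j hj x.2).2,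
    ENNReal.ofReal_pow (norm_nonneg _), ofReal_norm]
  simp only [mdiff, expect_zero_apply, Nat.cast_succ, add_assoc]

theorem truncSum_eq (f : Rm m × Rm m → ℂ) (k₀ : ℤ) (J : ℕ) (x : Rm m × Rm m) :
    truncSum f k₀ J x
      = (coef f (k₀ + J, k₀ + J) (cubeIndex (k₀ + J) x.1) (cubeIndex (k₀ + J) x.2)
        - coef f (k₀ + J, k₀) (cubeIndex (k₀ + J) x.1)
          ((parent (cubeTree m))^[J] (cubeIndex (k₀ + J) x.2)))
      - (coef f (k₀, k₀ + J) ((parent (cubeTree m))^[J] (cubeIndex (k₀ + J) x.1))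
          (cubeIndex (k₀ + J) x.2)
        - coef f (k₀, k₀) ((parent (cubeTree m))^[J] (cubeIndex (k₀ + J) x.1))
          ((parent (cubeTree m))^[J] (cubeIndex (k₀ + J) x.2))) := by
  simp only [truncSum, expect_zero_apply, iterate_parent_cubeIndex]

/-- The truncated functions are constant on tiles of the finest scale `k₀ + J`, so their integrals
are a fixed tile volume times sums over the tree. The function `f` itself enters only through Jensen
on these tiles. -/
theorem exists_lintegral_trunc_bounds (m : ℕ) {p : ℝ} (hp : 1 < p) :
    ∃ C : ℝ, 0 < C ∧ ∀ f : Rm m × Rm m → ℂ, MemLp f (ENNReal.ofReal p) volume →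
      ∀ (k₀ : ℤ) (J : ℕ),
      ∫⁻ x, truncSq f k₀ J x ^ (p / 2) ≤ ENNReal.ofReal C * ∫⁻ x, ‖f x‖ₑ ^ p ∧
      ∫⁻ x, ‖truncSum f k₀ J x‖ₑ ^ p ≤ ENNReal.ofReal C * ∫⁻ x, truncSq f k₀ J x ^ (p / 2) := by
  obtain ⟨C, hC, h⟩ := exists_tsum_biSq_bounds (Fin m → Fin 2) hp
  refine ⟨C, hC, fun f hf k₀ J => ?_⟩
  have hp0 : 0 < p := by linarith
  have hint : ∀ k n₁ n₂, IntegrableOn f (box k n₁ n₂) := fun k n₁ n₂ => by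
    have : IsFiniteMeasure (volume.restrict (box k n₁ n₂)) :=
      ⟨by rw [Measure.restrict_apply_univ, volume_box]; exact (boxVol_ne_top k).lt_top⟩
    exact (hf.restrict _).integrable (by simpa using hp.le)
  obtain ⟨h₁, h₂⟩ := h _ (cubeTree m) J (fun i j => coef f (k₀ + i, k₀ + j))
    (fun j n₂ => isTreeMart_coef_left J hint k₀ (k₀ + j) n₂)
    (fun i n₁ => isTreeMart_coef_right J hint k₀ (k₀ + i) n₁)
  have hsq : ∀ n₁ n₂, 0 ≤ biSq (cubeTree m) (fun i j => coef f (k₀ + i, k₀ + j)) J n₁ n₂ :=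
    fun n₁ n₂ => Finset.sum_nonneg fun _ _ => Finset.sum_nonneg fun _ _ => sq_nonneg _
  have e1 : ∫⁻ x, truncSq f k₀ J x ^ (p / 2) = boxVol m (k₀ + J, k₀ + J) * ∑' n₁, ∑' n₂,
      ENNReal.ofReal (biSq (cubeTree m) (fun i j => coef f (k₀ + i, k₀ + j)) J n₁ n₂
        ^ (p / 2)) := by
    rw [← lintegral_comp_cubeIndex]
    refine lintegral_congr fun x => ?_
    rw [truncSq_eq, ENNReal.ofReal_rpow_of_nonneg (hsq _ _) (by positivity)]
  rw [e1]
  constructor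
  · rw [lintegral_eq_tsum_box _ (k₀ + J, k₀ + J)]
    calc _ ≤ boxVol m (k₀ + J, k₀ + J) * (ENNReal.ofReal C * ∑' n₁, ∑' n₂,
          ENNReal.ofReal (‖coef f (k₀ + J, k₀ + J) n₁ n₂‖ ^ p)) := by gcongr
      _ = ENNReal.ofReal C * ∑' n₁, ∑' n₂, boxVol m (k₀ + J, k₀ + J) *
          ‖coef f (k₀ + J, k₀ + J) n₁ n₂‖ₑ ^ p := by
        simp only [ENNReal.tsum_mul_left, ← ENNReal.ofReal_rpow_of_nonneg (norm_nonneg _) hp0.le,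
          ofReal_norm]
        ring
      _ ≤ _ := by
        gcongr with n₁ n₂
        exact boxVol_mul_coef_rpow_le hf.1 hp.le _ _ _
  · have e2 : ∀ x, ‖truncSum f k₀ J x‖ₑ ^ p = ENNReal.ofReal (‖truncSum f k₀ J x‖ ^ p) := by
      intro x
      rw [← ENNReal.ofReal_rpow_of_nonneg (norm_nonneg _) hp0.le, ofReal_norm]
    simp only [e2]
    simp only [truncSum_eq]
    rw [lintegral_comp_cubeIndex (fun n₁ n₂ => ENNReal.ofReal (‖(coef f (k₀ + J, k₀ + J) n₁ n₂
        - coef f (k₀ + J, k₀) n₁ ((parent (cubeTree m))^[J] n₂))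
      - (coef f (k₀, k₀ + J) ((parent (cubeTree m))^[J] n₁) n₂
        - coef f (k₀, k₀) ((parent (cubeTree m))^[J] n₁)
          ((parent (cubeTree m))^[J] n₂))‖ ^ p)) (k₀ + J, k₀ + J), mul_left_comm]
    refine mul_le_mul_right ?_ _
    simpa using h₂

end Cubes

/-! ### Removal of the truncation -/

section Limits

open Filter Topology

variable {m : ℕ}

/-- In the sup norm a tile with equal side lengths is a ball up to its boundary, which makes
differentiation along balls applicable. -/
theorem box_ae_eq_closedBall (k : ℤ) (n₁ n₂ : Fin m → ℤ) :
    box (k, k) n₁ n₂ =ᵐ[volume] Metric.closedBall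
      ((fun j => ((n₁ j : ℝ) + 2⁻¹) * 2 ^ (-k), fun j => ((n₂ j : ℝ) + 2⁻¹) * 2 ^ (-k)) :
        Rm m × Rm m) (2⁻¹ * 2 ^ (-k)) := by
  have h0 : (0 : ℝ) ≤ 2⁻¹ * 2 ^ (-k) := by positivity
  have h : ∀ n : Fin m → ℤ, (dyadicCube k n : Set (Rm m)) =ᵐ[volume]
      Metric.closedBall (fun j => ((n j : ℝ) + 2⁻¹) * 2 ^ (-k)) (2⁻¹ * 2 ^ (-k)) := by
    intro n
    rw [dyadicCube_eq_pi, closedBall_pi _ h0]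
    have e : ∀ j, Metric.closedBall (((n j : ℝ) + 2⁻¹) * 2 ^ (-k)) (2⁻¹ * 2 ^ (-k))
        = Set.Icc ((n j : ℝ) * 2 ^ (-k)) (((n j : ℝ) + 1) * 2 ^ (-k)) := by
      intro j
      rw [Real.closedBall_eq_Icc]
      congr 1 <;> ring
    simp only [e]
    exact Measure.pi_Ico_ae_eq_pi_Icc
  rw [box, ← closedBall_prod_same]
  exact Measure.set_prod_ae_eq (h n₁) (h n₂)

/-- Lebesgue differentiation along the dyadic cubes. -/
theorem ae_tendsto_expect_zero {f : Rm m × Rm m → ℂ} (hf : LocallyIntegrable f volume) :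
    ∀ᵐ x, Tendsto (fun K : ℕ => expect 0 ((K : ℤ), (K : ℤ)) f x) atTop (𝓝 (f x)) := by
  filter_upwards [IsUnifLocDoublingMeasure.ae_tendsto_average volume hf 1] with x hx
  have hδ : Tendsto (fun K : ℕ => (2⁻¹ * 2 ^ (-(K : ℤ)) : ℝ)) atTop (𝓝[>] 0) := by
    refine tendsto_nhdsWithin_iff.2 ⟨?_, Eventually.of_forall fun K => ?_⟩
    · have := (tendsto_pow_atTop_nhds_zero_of_lt_one (r := (2⁻¹ : ℝ)) (by norm_num)
        (by norm_num)).const_mul 2⁻¹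
      simpa using this
    · exact Set.mem_Ioi.2 (by positivity)
  -- The balls are centred at the midpoints of the tiles, not at `x`; the theorem only needs `x` to
  -- lie in each ball, with dilation factor `1`.
  refine (hx (fun K : ℕ => ((fun j => ((cubeIndex K x.1 j : ℝ) + 2⁻¹) * 2 ^ (-(K : ℤ))),
    fun j => ((cubeIndex K x.2 j : ℝ) + 2⁻¹) * 2 ^ (-(K : ℤ)))) _ hδ
    (Eventually.of_forall fun K => ?_)).congr fun K => ?_
  · have h0 : (0 : ℝ) ≤ 2⁻¹ * 2 ^ (-(K : ℤ)) := by positivity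
    have h : ∀ y : Rm m, y ∈ Metric.closedBall
        (fun j => ((cubeIndex K y j : ℝ) + 2⁻¹) * 2 ^ (-(K : ℤ))) (2⁻¹ * 2 ^ (-(K : ℤ))) := by
      intro y
      rw [closedBall_pi _ h0, Set.mem_univ_pi]
      intro j
      have := mem_dyadicCube.2 (rfl : cubeIndex K y = _) j
      rw [Real.closedBall_eq_Icc]
      constructor <;> linarith
    rw [one_mul, ← closedBall_prod_same]
    exact ⟨h x.1, h x.2⟩
  · rw [expect_zero_apply, coef]
    exact (setAverage_congr (box_ae_eq_closedBall _ _ _)).symm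

theorem enorm_expect_zero_le {f : Rm m × Rm m → ℂ} (hf : AEStronglyMeasurable f volume)
    {p : ℝ} (hp : 1 ≤ p) (k : ℤ × ℤ) (x : Rm m × Rm m) :
    ‖expect 0 k f x‖ₑ ≤ ((boxVol m k)⁻¹ * ∫⁻ y, ‖f y‖ₑ ^ p) ^ (1 / p) := by
  have hp0 : 0 < p := by linarith
  rw [one_div, ENNReal.le_rpow_inv_iff hp0, expect_zero_apply, mul_comm, ← div_eq_mul_inv,
    ENNReal.le_div_iff_mul_le (Or.inl (boxVol_ne_zero k)) (Or.inl (boxVol_ne_top k)), mul_comm]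
  exact (boxVol_mul_coef_rpow_le hf hp k _ _).trans (setLIntegral_le_lintegral _ _)

/-- The volume is `2 ^ (-(k.1 + k.2) * m)`, so one very coarse side can outweigh a fine one. For `m
= 0` the volume would stay `1`. -/
theorem boxVol_inv_le (hm : 1 ≤ m) {k : ℤ × ℤ} {K : ℕ} (hk : k.1 + k.2 ≤ -K) :
    (boxVol m k)⁻¹ ≤ 2⁻¹ ^ K := by
  rw [← ENNReal.inv_pow, ENNReal.inv_le_inv, boxVol, ← mul_pow,
    ← ENNReal.ofReal_mul (by positivity), ← zpow_add₀ two_ne_zero,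
    ← ENNReal.ofReal_pow (by positivity)]
  have h1 : (2 : ℝ) ^ K ≤ 2 ^ (-k.1 + -k.2) := by
    rw [← zpow_natCast]
    exact zpow_le_zpow_right₀ (by norm_num) (by omega)
  have h2 : (1 : ℝ) ≤ 2 ^ K := one_le_pow₀ (by norm_num)
  have h3 : (2 : ℝ) ^ K ≤ (2 ^ (-k.1 + -k.2)) ^ m :=
    h1.trans (le_self_pow₀ (h2.trans h1) (by omega))
  calc (2 : ℝ≥0∞) ^ K = ENNReal.ofReal (2 ^ K) := by
        rw [ENNReal.ofReal_pow (by norm_num)]; simp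
    _ ≤ _ := ENNReal.ofReal_le_ofReal h3

theorem tendsto_expect_zero_of_add_le (hm : 1 ≤ m) {f : Rm m × Rm m → ℂ}
    {p : ℝ} (hp : 1 ≤ p) (hf : AEStronglyMeasurable f volume) (hfin : ∫⁻ y, ‖f y‖ₑ ^ p ≠ ∞)
    {k : ℕ → ℤ × ℤ} (hk : ∀ K, (k K).1 + (k K).2 ≤ -K) (x : Rm m × Rm m) :
    Tendsto (fun K => expect 0 (k K) f x) atTop (𝓝 0) := by
  rw [tendsto_zero_iff_enorm_tendsto_zero]
  have hp0 : 0 < p := by linarith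
  have h1 : Tendsto (fun K : ℕ => ((2⁻¹ : ℝ≥0∞) ^ K * ∫⁻ y, ‖f y‖ₑ ^ p) ^ (1 / p)) atTop (𝓝 0) := by
    have h2 : Tendsto (fun K : ℕ => (2⁻¹ : ℝ≥0∞) ^ K * ∫⁻ y, ‖f y‖ₑ ^ p) atTop (𝓝 0) := by
      have := ENNReal.Tendsto.mul_const
        (ENNReal.tendsto_pow_atTop_nhds_zero_of_lt_one (r := 2⁻¹) (by norm_num))
        (Or.inr hfin)
      simpa using this
    have h3 := (ENNReal.continuous_rpow_const (y := 1 / p)).tendsto 0 |>.comp h2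
    rw [ENNReal.zero_rpow_of_pos (by positivity)] at h3
    exact h3
  refine tendsto_of_tendsto_of_tendsto_of_le_of_le tendsto_const_nhds h1 (fun _ => zero_le)
    fun K => (enorm_expect_zero_le hf hp (k K) x).trans ?_
  gcongr
  exact boxVol_inv_le hm (hk K)

/-- The window from `-2 * K` to `K` is asymmetric on purpose: in the mixed terms the scales add up
to `-K`, so those tiles also grow without bound. A symmetric window would leave their volume equal
to `1`. -/
theorem ae_tendsto_truncSum (hm : 1 ≤ m) {f : Rm m × Rm m → ℂ} {p : ℝ} (hp : 1 ≤ p)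
    (hf : MemLp f (ENNReal.ofReal p) volume) (hfin : ∫⁻ y, ‖f y‖ₑ ^ p ≠ ∞) :
    ∀ᵐ x, Tendsto (fun K : ℕ => truncSum f (-2 * K) (3 * K) x) atTop (𝓝 (f x)) := by
  filter_upwards [ae_tendsto_expect_zero (hf.locallyIntegrable (by simpa using hp))] with x hx
  have h : ∀ K : ℕ, -2 * (K : ℤ) + (3 * K : ℕ) = K := fun K => by push_cast; ring
  simp only [truncSum, h]
  have h1 := tendsto_expect_zero_of_add_le hm hp hf.1 hfin
    (k := fun K : ℕ => ((K : ℤ), -2 * (K : ℤ))) (fun K => by simp only; omega) x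
  have h2 := tendsto_expect_zero_of_add_le hm hp hf.1 hfin
    (k := fun K : ℕ => (-2 * (K : ℤ), (K : ℤ))) (fun K => by simp only; omega) x
  have h3 := tendsto_expect_zero_of_add_le hm hp hf.1 hfin
    (k := fun K : ℕ => (-2 * (K : ℤ), -2 * (K : ℤ))) (fun K => by simp only; omega) x
  simpa using (hx.sub h1).sub (h2.sub h3)

/-- The embedding of pairs of naturals as the scales from `k₀` upwards. -/
def scaleEmbedding (k₀ : ℤ) : ℕ × ℕ ↪ ℤ × ℤ :=
  ⟨fun i => (k₀ + i.1, k₀ + i.2), fun i j h => by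
    simp only [Prod.mk.injEq, add_right_inj, Nat.cast_inj] at h
    exact Prod.ext h.1 h.2⟩

/-- The scales in `[-2K, K)²`. -/
def scales (K : ℕ) : Finset (ℤ × ℤ) :=
  (Finset.range (3 * K) ×ˢ Finset.range (3 * K)).map (scaleEmbedding (-2 * K))

theorem mem_scales {K : ℕ} {k : ℤ × ℤ} :
    k ∈ scales K ↔ (-2 * K ≤ k.1 ∧ k.1 < K) ∧ (-2 * K ≤ k.2 ∧ k.2 < K) := by
  simp only [scales, Finset.mem_map, Finset.mem_product, Finset.mem_range, Prod.exists]
  constructor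
  · rintro ⟨i, j, ⟨hi, hj⟩, rfl⟩
    change (_ ≤ -2 * (K : ℤ) + i ∧ -2 * (K : ℤ) + i < K) ∧
      (_ ≤ -2 * (K : ℤ) + j ∧ -2 * (K : ℤ) + j < K)
    omega
  · rintro ⟨⟨h1, h2⟩, h3, h4⟩
    refine ⟨(k.1 + 2 * K).toNat, (k.2 + 2 * K).toNat, by omega, Prod.ext ?_ ?_⟩
    · change -2 * (K : ℤ) + (k.1 + 2 * K).toNat = k.1
      omega
    · change -2 * (K : ℤ) + (k.2 + 2 * K).toNat = k.2
      omega

theorem truncSq_eq_sum_scales (f : Rm m × Rm m → ℂ) (K : ℕ) (x : Rm m × Rm m) :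
    truncSq f (-2 * K) (3 * K) x = ∑ k ∈ scales K, ‖mdiff 0 k f x‖ₑ ^ 2 := by
  rw [scales, Finset.sum_map, Finset.sum_product_right]
  rfl

theorem tendsto_truncSq (f : Rm m × Rm m → ℂ) (x : Rm m × Rm m) :
    Tendsto (fun K : ℕ => truncSq f (-2 * K) (3 * K) x) atTop
      (𝓝 (∑' k, ‖mdiff 0 k f x‖ₑ ^ 2)) := by
  simp only [truncSq_eq_sum_scales]
  refine ENNReal.summable.hasSum.comp (tendsto_atTop_finset_of_monotone ?_ fun k => ?_)
  · intro K L h k hk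
    rw [mem_scales] at hk ⊢
    omega
  -- The extra `1` is needed because the window excludes its upper end.
  · refine ⟨k.1.natAbs + k.2.natAbs + 1, mem_scales.2 ?_⟩
    generalize k.1 = a
    generalize k.2 = b
    omega

theorem truncSq_le_tsum (f : Rm m × Rm m → ℂ) (K : ℕ) (x : Rm m × Rm m) :
    truncSq f (-2 * K) (3 * K) x ≤ ∑' k, ‖mdiff 0 k f x‖ₑ ^ 2 := by
  rw [truncSq_eq_sum_scales]
  exact ENNReal.sum_le_tsum _

theorem measurable_truncSq (f : Rm m × Rm m → ℂ) (k₀ : ℤ) (J : ℕ) :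
    Measurable (truncSq f k₀ J) :=
  Finset.measurable_fun_sum _ fun _ _ => Finset.measurable_fun_sum _ fun _ _ =>
    (measurable_mdiff_zero _ f).enorm.pow_const 2

theorem measurable_truncSum (f : Rm m × Rm m → ℂ) (k₀ : ℤ) (J : ℕ) :
    Measurable (truncSum f k₀ J) :=
  ((measurable_expect_zero _ f).sub (measurable_expect_zero _ f)).sub
    ((measurable_expect_zero _ f).sub (measurable_expect_zero _ f))

theorem measurable_martSquare_zero (f : Rm m × Rm m → ℂ) : Measurable (martSquare 0 f) :=
  (Measurable.tsum fun _ => (measurable_mdiff_zero _ f).enorm.pow_const 2).pow_const _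

theorem martSquare_rpow (i : Fin 3) (f : Rm m × Rm m → ℂ) (p : ℝ) (x : Rm m × Rm m) :
    martSquare i f x ^ p = (∑' k, ‖mdiff i k f x‖ₑ ^ 2) ^ (p / 2) := by
  rw [martSquare, ← ENNReal.rpow_mul]
  congr 1
  ring

/-- Fatou's lemma on both sides: for the square functions, which converge everywhere, and for the
telescoped sums, which converge to `f` almost everywhere. -/
theorem exists_lintegral_martSquare_bounds (hm : 1 ≤ m) {p : ℝ} (hp : 1 < p) :
    ∃ C : ℝ, 0 < C ∧ ∀ f : Rm m × Rm m → ℂ, MemLp f (ENNReal.ofReal p) volume →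
      ∫⁻ x, martSquare 0 f x ^ p ≤ ENNReal.ofReal C * ∫⁻ x, ‖f x‖ₑ ^ p ∧
      ∫⁻ x, ‖f x‖ₑ ^ p ≤ ENNReal.ofReal C * ∫⁻ x, martSquare 0 f x ^ p := by
  obtain ⟨C, hC, h⟩ := exists_lintegral_trunc_bounds m hp
  have hp0 : 0 < p := by linarith
  refine ⟨C, hC, fun f hf => ?_⟩
  have hfin : ∫⁻ y, ‖f y‖ₑ ^ p ≠ ∞ := by
    have := lintegral_rpow_enorm_lt_top_of_eLpNorm_lt_top (by simpa using hp0)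
      ENNReal.ofReal_ne_top hf.2
    rw [ENNReal.toReal_ofReal hp0.le] at this
    exact this.ne
  simp only [martSquare_rpow]
  constructor
  · have hlim : ∀ x, (∑' k, ‖mdiff 0 k f x‖ₑ ^ 2) ^ (p / 2)
        = liminf (fun K : ℕ => truncSq f (-2 * K) (3 * K) x ^ (p / 2)) atTop := fun x =>
      (((ENNReal.continuous_rpow_const (y := p / 2)).tendsto _).comp
        (tendsto_truncSq f x)).liminf_eq.symm
    simp only [hlim]
    refine (lintegral_liminf_le fun K => (measurable_truncSq f _ _).pow_const _).trans ?_
    refine liminf_le_of_le (by isBoundedDefault) fun b hb => ?_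
    obtain ⟨K, hK⟩ := hb.exists
    exact hK.trans (h f hf _ _).1
  · have hlim : ∀ᵐ x, ‖f x‖ₑ ^ p
        = liminf (fun K : ℕ => ‖truncSum f (-2 * K) (3 * K) x‖ₑ ^ p) atTop := by
      filter_upwards [ae_tendsto_truncSum hm hp.le hf hfin] with x hx
      exact (((ENNReal.continuous_rpow_const (y := p)).tendsto _).comp hx.enorm).liminf_eq.symm
    rw [lintegral_congr_ae hlim]
    refine (lintegral_liminf_le fun K => (measurable_truncSum f _ _).enorm.pow_const _).trans ?_
    refine liminf_le_of_le (by isBoundedDefault) fun b hb => ?_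
    obtain ⟨K, hK⟩ := hb.exists
    refine (hK.trans (h f hf _ _).2).trans ?_
    gcongr with x
    exact truncSq_le_tsum f K x

end Limits

/-! ### Reduction of the sheared systems to the product system -/

section Shear

variable {m : ℕ}

/-- The shears as measurable equivalences. -/
def shearEquiv (m : ℕ) (i : Fin 3) : Rm m × Rm m ≃ᵐ Rm m × Rm m where
  toFun := shear i
  invFun := match i with
    | 0 => fun x => x
    | 1 => fun x => (x.1 + x.2, x.2)
    | 2 => fun x => (x.1, x.2 + x.1)
  left_inv x := by fin_cases i <;> simp [shear]
  right_inv x := by fin_cases i <;> simp [shear]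
  measurable_toFun := by
    fin_cases i
    · exact measurable_id
    · exact (measurable_fst.sub measurable_snd).prodMk measurable_snd
    · exact measurable_fst.prodMk (measurable_snd.sub measurable_fst)
  measurable_invFun := by
    fin_cases i
    · exact measurable_id
    · exact (measurable_fst.add measurable_snd).prodMk measurable_snd
    · exact measurable_fst.prodMk (measurable_snd.add measurable_fst)

theorem measurePreserving_shear (i : Fin 3) :
    MeasurePreserving (shearEquiv m i) volume volume := by
  fin_cases i
  · exact MeasurePreserving.id _
  · exact measurePreserving_sub_prod volume volume
  · exact measurePreserving_prod_sub volume volume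

/-- Tiles correspond under a measure preserving bijection, so the averages agree by change of
variables. -/
theorem expect_comp_shear (i : Fin 3) (k : ℤ × ℤ) (g : Rm m × Rm m → ℂ) (x : Rm m × Rm m) :
    expect i k (fun y => g (shearEquiv m i y)) x = expect 0 k g (shearEquiv m i x) := by
  have htile : ∀ n, tile i k n = shearEquiv m i ⁻¹' tile 0 k n := fun n => rfl
  have hmp := measurePreserving_shear (m := m) i
  refine tsum_congr fun n => ?_
  rw [htile, setAverage_eq, setAverage_eq, hmp.setIntegral_preimage_emb
    (shearEquiv m i).measurableEmbedding, Measure.real, Measure.real,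
    hmp.measure_preimage_equiv]
  rfl

theorem martSquare_comp_shear (i : Fin 3) (g : Rm m × Rm m → ℂ) :
    martSquare i (g ∘ shearEquiv m i) = martSquare 0 g ∘ shearEquiv m i := by
  ext x
  simp only [martSquare, mdiff, Function.comp_def, expect_comp_shear]

end Shear

end TwistedDyadic

end

/-! ### Passage from integrals to norms for all three systems -/

theorem mainTheorem1 (m : ℕ) (hm : 1 ≤ m) (p : ℝ≥0∞) (hp : 1 < p) (hp' : p < ∞) :
    ∃ c C : ℝ≥0, 0 < c ∧ 0 < C ∧
      ∀ (i : Fin 3) (f : TwistedDyadic.Rm m × TwistedDyadic.Rm m → ℂ),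
        MemLp f p volume →
          MemLp (TwistedDyadic.martSquare i f) p volume ∧
          (c : ℝ≥0∞) * eLpNorm f p volume
            ≤ eLpNorm (TwistedDyadic.martSquare i f) p volume ∧
          eLpNorm (TwistedDyadic.martSquare i f) p volume
            ≤ (C : ℝ≥0∞) * eLpNorm f p volume := by
  obtain ⟨r, hr0, rfl⟩ : ∃ r : ℝ, 0 ≤ r ∧ p = ENNReal.ofReal r :=
    ⟨p.toReal, ENNReal.toReal_nonneg, (ENNReal.ofReal_toReal hp'.ne).symm⟩
  have hr : 1 < r := by simpa using hp
  have hr1 : 0 < r := by linarith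
  obtain ⟨C, hC, h⟩ := TwistedDyadic.exists_lintegral_martSquare_bounds hm hr
  -- The integral estimates compare `r`-th powers, so the norms compare with the `r`-th root of `C`;
  -- it serves both directions, with `c = D⁻¹`.
  set D : ℝ≥0 := (Real.toNNReal C) ^ (1 / r) with hD
  have hD0 : 0 < D := NNReal.rpow_pos (Real.toNNReal_pos.2 hC)
  have hDC : (D : ℝ≥0∞) = ENNReal.ofReal C ^ (1 / r) := by
    rw [hD, ENNReal.coe_rpow_of_nonneg _ (by positivity)]; rfl
  have hp0 : ENNReal.ofReal r ≠ 0 := by simpa using hr1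
  refine ⟨D⁻¹, D, inv_pos.2 hD0, hD0, fun i f hf => ?_⟩
  have hmp := TwistedDyadic.measurePreserving_shear (m := m) i
  set T := TwistedDyadic.shearEquiv m i
  obtain ⟨g, rfl⟩ : ∃ g, f = g ∘ T := ⟨f ∘ T.symm, by ext x; simp⟩
  have hg : MemLp g (ENNReal.ofReal r) volume := by
    have := hf.comp_measurePreserving (hmp.symm T)
    simpa [Function.comp_assoc] using this
  have hS := TwistedDyadic.measurable_martSquare_zero g
  obtain ⟨hup, hlow⟩ := h g hg
  rw [TwistedDyadic.martSquare_comp_shear, eLpNorm_comp_measurePreserving hg.1 hmp,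
    eLpNorm_comp_measurePreserving hS.aestronglyMeasurable hmp]
  have eg : eLpNorm g (ENNReal.ofReal r) volume = (∫⁻ x, ‖g x‖ₑ ^ r) ^ (1 / r) := by
    rw [eLpNorm_eq_lintegral_rpow_enorm_toReal hp0 ENNReal.ofReal_ne_top,
      ENNReal.toReal_ofReal hr0]
  have eS : eLpNorm (TwistedDyadic.martSquare 0 g) (ENNReal.ofReal r) volume
      = (∫⁻ x, TwistedDyadic.martSquare 0 g x ^ r) ^ (1 / r) := by
    rw [eLpNorm_eq_lintegral_rpow_enorm_toReal hp0 ENNReal.ofReal_ne_top,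
      ENNReal.toReal_ofReal hr0]
    rfl
  have hup' : eLpNorm (TwistedDyadic.martSquare 0 g) (ENNReal.ofReal r) volume
      ≤ D * eLpNorm g (ENNReal.ofReal r) volume := by
    rw [eS, eg, hDC, ← ENNReal.mul_rpow_of_nonneg _ _ (by positivity)]
    gcongr
  have hlow' : eLpNorm g (ENNReal.ofReal r) volume
      ≤ D * eLpNorm (TwistedDyadic.martSquare 0 g) (ENNReal.ofReal r) volume := by
    rw [eS, eg, hDC, ← ENNReal.mul_rpow_of_nonneg _ _ (by positivity)]
    gcongr
  refine ⟨⟨(hS.comp T.measurable).aestronglyMeasurable, ?_⟩, ?_, hup'⟩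
  · rw [eLpNorm_comp_measurePreserving hS.aestronglyMeasurable hmp]
    exact hup'.trans_lt (ENNReal.mul_lt_top ENNReal.coe_lt_top hg.2)
  · rw [ENNReal.coe_inv hD0.ne', ENNReal.inv_mul_le_iff (by simpa using hD0.ne') ENNReal.coe_ne_top]
    exact hlow'
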